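/- **Setting.** For $n\ge 0$ let $L^2(\mathbb{R}_+^n)=L^2(\mathbb{R}_+^n;\mathbb{C})$ with Lebesgue measure ($L^2(\mathbb{R}_+^0)=\mathbb{C}$), and let $\mathcal F=\bigoplus_{n\ge 0}L^2(\mathbb{R}_+^n)$ be the full Fock space over $L^2(\mathbb{R}_+)$, where $L^2(\mathbb{R}_+)^{\otimes n}$ is identified with $L^2(\mathbb{R}_+^n)$, with vacuum vector $\Omega=1\in L^2(\mathbb{R}_+^0)$. For $h\in L^2(\mathbb{R}_+)$ let $l(h)$ be the left creation operator, $l(h)\xi=h\otimes \xi$, let $l^*(h)$ be its adjoint, and $S(h)=l(h)+l^*(h)$. Let $\mathcal{SC}=\{S(h): h\in L^2(\mathbb{R}_+)\text{ real-valued}\}''\subset\mathcal B(\mathcal F)$, $\tau(X)=\langle X\Omega,\Omega\rangle$, $\|X\|_2=\tau(X^*X)^{1/2}$, and let $S_t=S(\mathbf 1_{[0,t]})$, $t\ge 0$, be the free Brownian motion. **Multiple Wigner integrals.** For a rectangle $A=[u_1,v_1]\times\dots\times[u_n,v_n]\subset\mathbb{R}_+^n$ containing no point with two equal coordinates, put $I_n(\mathbf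 1_A)=(S_{v_1}-S_{u_1})\cdots(S_{v_n}-S_{u_n})$, and extend linearly to finite linear combinations of such indicators (simple functions). For $f\in L^2(\mathbb{R}_+^n)$, the multiple Wigner integral $I_n(f)$ is the element $X\in\mathcal{SC}$ for which there are simple functions $\varphi_k\to f$ in $L^2(\mathbb{R}_+^n)$ with $\|I_n(\varphi_k)-X\|_2\to 0$. **Nested contractions.** For $f\in L^2(\mathbb{R}_+^n)$, $g\in L^2(\mathbb{R}_+^m)$ and $0\le p\le n\wedge m$, let $f\stackrel{p}{\frown}g\in L^2(\mathbb{R}_+^{n+m-2p})$ be given almost everywhere by $$f\stackrel{p}{\frown} g(t_1,\dots,t_{n+m-2p})=\int_{\mathbb{R}_+^p}f(t_1,\dots,t_{n-p},s_p,\dots,s_1)\,g(s_1,\dots,s_p,t_{n-p+1},\dots,t_{n+m-2p})\,ds_1\cdots ds_p.$$ **Statement.** For every $k\ge 0$ and $h\in L^2(\mathbb{R}_+^k)$ there is exactly one operator $I_k(h)\in\mathcal{SC}$ as above, so multiple Wigner integrals are well-defined bounded operators and can be multiplied. For all $n,m\ge 0$, $f\in L^2(\mathbb{R}_+^n)$ and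 $g\in L^2(\mathbb{R}_+^m)$, $$I_n(f)\,I_m(g)=\sum_{p=0}^{n\wedge m}I_{n+m-2p}\bigl(f\stackrel{p}{\frown}g\bigr).$$ -/

import Mathlib

open MeasureTheory Filter Topology
open scoped ENNReal

noncomputable section

namespace Wigner

/-- Lebesgue measure on `ℝ₊ = [0, ∞)`, as a measure on `ℝ` carried by `[0, ∞)`. -/
def halfLine : Measure ℝ := volume.restrict (Set.Ici 0)

instance : SigmaFinite halfLine := by unfold halfLine; infer_instance

/-- Lebesgue measure on `ℝ₊ⁿ`; for `n = 0` it is the unit mass on a point. -/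
def orthant (n : ℕ) : Measure (Fin n → ℝ) := Measure.pi (fun _ : Fin n => halfLine)

instance (n : ℕ) : SigmaFinite (orthant n) := by unfold orthant; infer_instance

/-- The complex Hilbert space `L²(ℝ₊)`. -/
abbrev OneParticle : Type := Lp ℂ 2 halfLine

/-- The complex Hilbert space `L²(ℝ₊ⁿ)`, identified with the `n`-th tensor power of `L²(ℝ₊)`. -/
abbrev Kernel (n : ℕ) : Type := Lp ℂ 2 (orthant n)

/-- The full Fock space over `L²(ℝ₊)`: the Hilbert direct sum of the spaces `L²(ℝ₊ⁿ)`, `n ≥ 0`. -/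
abbrev Fock : Type := lp Kernel 2

/-- The vacuum vector: the constant `1` in `L²(ℝ₊⁰) = ℂ`. -/
def vacuum : Fock :=
  lp.single 2 0 (indicatorConstLp 2 (μ := orthant 0) MeasurableSet.univ
    (by simp [orthant]) (1 : ℂ))

theorem memLp_tensor {α β : Type*} [MeasurableSpace α] [MeasurableSpace β]
    {μ : Measure α} {ν : Measure β} [SigmaFinite μ] [SigmaFinite ν] {f : α → ℂ} {g : β → ℂ}
    (hf : MemLp f 2 μ) (hg : MemLp g 2 ν) :
    MemLp (fun z : α × β => f z.1 * g z.2) 2 (μ.prod ν) ∧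
      eLpNorm (fun z : α × β => f z.1 * g z.2) 2 (μ.prod ν) = eLpNorm f 2 μ * eLpNorm g 2 ν := by
  have key : eLpNorm (fun z : α × β => f z.1 * g z.2) 2 (μ.prod ν)
      = eLpNorm f 2 μ * eLpNorm g 2 ν := by
    have h2 : (2 : ℝ≥0∞) ≠ 0 := by norm_num
    have h2' : (2 : ℝ≥0∞) ≠ ⊤ := by norm_num
    rw [eLpNorm_eq_lintegral_rpow_enorm_toReal h2 h2', eLpNorm_eq_lintegral_rpow_enorm_toReal h2 h2',
      eLpNorm_eq_lintegral_rpow_enorm_toReal h2 h2', ← ENNReal.mul_rpow_of_nonneg _ _ (by norm_num)]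
    congr 1
    rw [← lintegral_prod_mul (hf.1.enorm.pow_const _) (hg.1.enorm.pow_const _)]
    refine lintegral_congr fun z => ?_
    rw [enorm_mul, ENNReal.mul_rpow_of_nonneg _ _ (by norm_num)]
  refine ⟨⟨hf.1.comp_fst.mul hg.1.comp_snd, ?_⟩, key⟩
  rw [key]
  exact ENNReal.mul_lt_top hf.2 hg.2

theorem measurePreserving_head (n : ℕ) :
    MeasurePreserving (fun t : Fin (n + 1) → ℝ => (t 0, fun i : Fin n => t i.succ))
      (orthant (n + 1)) (halfLine.prod (orthant n)) :=
  measurePreserving_piFinSuccAbove (fun _ : Fin (n + 1) => halfLine) 0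

theorem memLp_prepend {n : ℕ} (h : OneParticle) (f : Kernel n) :
    MemLp (fun t : Fin (n + 1) → ℝ => h (t 0) * f (fun i => t i.succ)) 2 (orthant (n + 1)) :=
  (memLp_tensor (Lp.memLp h) (Lp.memLp f)).1.comp_measurePreserving (measurePreserving_head n)

/-- The tensor `h ⊗ f`, that is `(t₁, …, tₙ₊₁) ↦ h(t₁) f(t₂, …, tₙ₊₁)`. -/
def prepend {n : ℕ} (h : OneParticle) (f : Kernel n) : Kernel (n + 1) :=
  (memLp_prepend h f).toLp _

theorem norm_prepend {n : ℕ} (h : OneParticle) (f : Kernel n) :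
    ‖prepend h f‖ = ‖h‖ * ‖f‖ := by
  obtain ⟨H1, H2⟩ := memLp_tensor (Lp.memLp h) (Lp.memLp f)
  have H3 : eLpNorm (fun t : Fin (n + 1) → ℝ => h (t 0) * f (fun i => t i.succ)) 2
      (orthant (n + 1)) = eLpNorm h 2 halfLine * eLpNorm f 2 (orthant n) :=
    (eLpNorm_comp_measurePreserving H1.1 (measurePreserving_head n)).trans H2
  rw [prepend, Lp.norm_toLp, H3, ENNReal.toReal_mul, Lp.norm_def, Lp.norm_def]

theorem tail_ae {n : ℕ} {p : (Fin n → ℝ) → Prop} (hp : ∀ᵐ s ∂(orthant n), p s) :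
    ∀ᵐ t ∂(orthant (n + 1)), p (fun i : Fin n => t i.succ) :=
  (Measure.quasiMeasurePreserving_snd.comp
    (measurePreserving_head n).quasiMeasurePreserving).ae hp

theorem prepend_add {n : ℕ} (h : OneParticle) (f g : Kernel n) :
    prepend h (f + g) = prepend h f + prepend h g := by
  refine Eq.trans ?_ (MemLp.toLp_add (memLp_prepend h f) (memLp_prepend h g))
  refine (MemLp.toLp_eq_toLp_iff _ _).2 ?_
  filter_upwards [tail_ae (Lp.coeFn_add f g)] with t ht
  simp only [Pi.add_apply] at ht ⊢
  rw [ht, mul_add]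

theorem prepend_smul {n : ℕ} (h : OneParticle) (c : ℂ) (f : Kernel n) :
    prepend h (c • f) = c • prepend h f := by
  refine Eq.trans ?_ (MemLp.toLp_const_smul c (memLp_prepend h f))
  refine (MemLp.toLp_eq_toLp_iff _ _).2 ?_
  filter_upwards [tail_ae (Lp.coeFn_smul c f)] with t ht
  simp only [Pi.smul_apply, smul_eq_mul] at ht ⊢
  rw [ht]
  ring

/-- The components of `l(h) ξ`. -/
def creationComponent (h : OneParticle) (ξ : ∀ n, Kernel n) : ∀ n, Kernel n
  | 0 => 0
  | n + 1 => prepend h (ξ n)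

theorem hasSum_creation (h : OneParticle) (ξ : Fock) :
    HasSum (fun n => ‖creationComponent h ξ n‖ ^ (2 : ℝ)) (‖h‖ ^ (2 : ℝ) * ‖ξ‖ ^ (2 : ℝ)) := by
  have h1 : HasSum (fun n => ‖ξ n‖ ^ (2 : ℝ)) (‖ξ‖ ^ (2 : ℝ)) := by
    simpa using lp.hasSum_norm (p := 2) (by norm_num) ξ
  rw [← hasSum_nat_add_iff' 1]
  simpa [creationComponent, norm_prepend, mul_pow] using h1.mul_left (‖h‖ ^ (2 : ℝ))

theorem memℓp_creation (h : OneParticle) (ξ : Fock) : Memℓp (creationComponent h ξ) 2 :=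
  memℓp_gen (by simpa using (hasSum_creation h ξ).summable)

/-- The left creation operator `l(h)` on the full Fock space. -/
def creation (h : OneParticle) : Fock →L[ℂ] Fock :=
  LinearMap.mkContinuous
    { toFun := fun ξ => ⟨creationComponent h ξ, memℓp_creation h ξ⟩
      map_add' := fun ξ η => by
        ext1; funext n
        cases n with
        | zero => exact (add_zero (0 : Kernel 0)).symm
        | succ n => exact prepend_add h (ξ n) (η n)
      map_smul' := fun c ξ => by
        ext1; funext n
        cases n with
        | zero => exact (smul_zero c : c • (0 : Kernel 0) = 0).symm
        | succ n => exact prepend_smul h c (ξ n) }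
    ‖h‖
    (fun ξ => by
      have h1 : (0 : ℝ) < (2 : ℝ≥0∞).toReal := by norm_num
      have h2 := (lp.hasSum_norm h1 (⟨creationComponent h ξ, memℓp_creation h ξ⟩ : Fock)).unique
        (by simpa using hasSum_creation h ξ)
      have h3 : ‖(⟨creationComponent h ξ, memℓp_creation h ξ⟩ : Fock)‖ ^ 2 = (‖h‖ * ‖ξ‖) ^ 2 := by
        rw [mul_pow]
        simpa using h2
      exact le_of_eq ((sq_eq_sq₀ (norm_nonneg _) (by positivity)).1 h3))

/-- The left annihilation operator `l*(h)`, the adjoint of `l(h)`. -/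
def annihilation (h : OneParticle) : Fock →L[ℂ] Fock :=
  ContinuousLinearMap.adjoint (creation h)

/-- The semicircular operator `S(h) = l(h) + l*(h)`. -/
def semicircular (h : OneParticle) : Fock →L[ℂ] Fock :=
  creation h + annihilation h

/-- The von Neumann algebra `{S(h) : h ∈ L²(ℝ₊) real valued}''`, as a bicommutant. -/
def wignerAlgebra : Set (Fock →L[ℂ] Fock) :=
  Set.centralizer (Set.centralizer
    {X | ∃ h : OneParticle, (∀ᵐ t ∂halfLine, (h t).im = 0) ∧ X = semicircular h})

/-- The vacuum state `τ(X) = ⟨X Ω, Ω⟩` (linear in `X`). -/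
def vacuumState (X : Fock →L[ℂ] Fock) : ℂ := inner ℂ vacuum (X vacuum)

/-- The norm `‖X‖₂ = τ(X* X)^{1/2}` of `L²(τ)`. -/
def norm2 (X : Fock →L[ℂ] Fock) : ℝ := Real.sqrt (vacuumState (star X * X)).re

theorem halfLine_Icc_ne_top (a b : ℝ) : halfLine (Set.Icc a b) ≠ ⊤ :=
  ((Measure.restrict_apply_le _ _).trans_lt measure_Icc_lt_top).ne

/-- The free Brownian motion `S_t = S(1_{[0,t]})`. -/
def brownian (t : ℝ) : Fock →L[ℂ] Fock :=
  semicircular (indicatorConstLp 2 (μ := halfLine) (measurableSet_Icc (a := 0) (b := t))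
    (halfLine_Icc_ne_top 0 t) (1 : ℂ))

/-- The union of the diagonals: the points with two equal coordinates. -/
def diagonals (n : ℕ) : Set (Fin n → ℝ) := {t | ∃ i j, i ≠ j ∧ t i = t j}

/-- A rectangle `[u₁,v₁] × … × [uₙ,vₙ] ⊆ ℝ₊ⁿ` that does not meet the diagonals. -/
structure Rectangle (n : ℕ) where
  lower : Fin n → ℝ
  upper : Fin n → ℝ
  lower_nonneg : ∀ i, 0 ≤ lower i
  lower_le_upper : ∀ i, lower i ≤ upper i
  off_diagonal : Disjoint (Set.Icc lower upper) (diagonals n)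

theorem orthant_Icc_ne_top {n : ℕ} (u v : Fin n → ℝ) : orthant n (Set.Icc u v) ≠ ⊤ := by
  rw [orthant, ← Set.pi_univ_Icc, Measure.pi_pi]
  exact ENNReal.prod_ne_top fun i _ => halfLine_Icc_ne_top _ _

/-- The characteristic function of a rectangle. -/
def Rectangle.kernel {n : ℕ} (A : Rectangle n) : Kernel n :=
  indicatorConstLp 2 (μ := orthant n) (measurableSet_Icc (a := A.lower) (b := A.upper))
    (orthant_Icc_ne_top _ _) (1 : ℂ)

/-- The product `(S_{v₁} - S_{u₁}) ⋯ (S_{vₙ} - S_{uₙ})`, in this order. -/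
def Rectangle.integral {n : ℕ} (A : Rectangle n) : Fock →L[ℂ] Fock :=
  (List.ofFn fun i => brownian (A.upper i) - brownian (A.lower i)).prod

/-- A simple function off the diagonals, presented as a formal linear combination
`∑ aᵢ 1_{Aᵢ}` of rectangles. -/
abbrev Simple (n : ℕ) : Type := Rectangle n →₀ ℂ

/-- The element `∑ aᵢ 1_{Aᵢ}` of `L²(ℝ₊ⁿ)`. -/
def Simple.kernel {n : ℕ} (φ : Simple n) : Kernel n := φ.sum fun A a => a • A.kernel

/-- The multiple Wigner integral `∑ aᵢ Iₙ(1_{Aᵢ})` of a simple function. -/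
def Simple.integral {n : ℕ} (φ : Simple n) : Fock →L[ℂ] Fock := φ.sum fun A a => a • A.integral

/-- `X` is the multiple Wigner integral of order `n` of `f`: it is an element of the von Neumann
algebra, and it is the limit in `L²(τ)` of the integrals of simple functions that converge to `f`
in `L²(ℝ₊ⁿ)`. -/
def IsWignerIntegral (n : ℕ) (f : Kernel n) (X : Fock →L[ℂ] Fock) : Prop :=
  X ∈ wignerAlgebra ∧ ∃ φ : ℕ → Simple n,
    Tendsto (fun k => (φ k).kernel) atTop (𝓝 f) ∧
    Tendsto (fun k => norm2 ((φ k).integral - X)) atTop (𝓝 0)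

/-- The multiple Wigner integral `Iₙ(f)`, as a bounded operator: the operator `X` with
`IsWignerIntegral n f X`. -/
def wignerIntegral (n : ℕ) (f : Kernel n) : Fock →L[ℂ] Fock :=
  Classical.epsilon (IsWignerIntegral n f)

/-- The argument `(t₁, …, t_{n-p}, s_p, …, s₁)` of `f` in the nested contraction. -/
def leftArg {n m p : ℕ} (hn : p ≤ n) (hm : p ≤ m) (t : Fin (n + m - 2 * p) → ℝ)
    (s : Fin p → ℝ) : Fin n → ℝ :=
  fun i => if h : (i : ℕ) < n - p then t ⟨i, by omega⟩ else s ⟨n - 1 - i, by omega⟩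

/-- The argument `(s₁, …, s_p, t_{n-p+1}, …, t_{n+m-2p})` of `g` in the nested contraction. -/
def rightArg {n m p : ℕ} (hn : p ≤ n) (hm : p ≤ m) (t : Fin (n + m - 2 * p) → ℝ)
    (s : Fin p → ℝ) : Fin m → ℝ :=
  fun j => if h : (j : ℕ) < p then s ⟨j, h⟩ else t ⟨n - p + (j - p), by omega⟩

/-- The function `t ↦ ∫ f(t₁, …, t_{n-p}, s_p, …, s₁) g(s₁, …, s_p, t_{n-p+1}, …) ds`. -/
def contractionFun {n m p : ℕ} (hn : p ≤ n) (hm : p ≤ m) (f : Kernel n) (g : Kernel m) :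
    (Fin (n + m - 2 * p) → ℝ) → ℂ :=
  fun t => ∫ s, f (leftArg hn hm t s) * g (rightArg hn hm t s) ∂(orthant p)

theorem memLp_partial_integral {α β σ : Type*} [MeasurableSpace α] [MeasurableSpace β]
    [MeasurableSpace σ] {μ : Measure α} {ν : Measure β} {ρ : Measure σ} [SigmaFinite μ]
    [SigmaFinite ν] [SigmaFinite ρ] {F : α × σ → ℂ} {G : σ × β → ℂ} (hFm : StronglyMeasurable F)
    (hGm : StronglyMeasurable G) (hF : MemLp F 2 (μ.prod ρ)) (hG : MemLp G 2 (ρ.prod ν)) :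
    MemLp (fun z : α × β => ∫ s, F (z.1, s) * G (s, z.2) ∂ρ) 2 (μ.prod ν) := by
  have hm : StronglyMeasurable (fun w : (α × β) × σ => F (w.1.1, w.2) * G (w.2, w.1.2)) :=
    (hFm.comp_measurable (by fun_prop)).mul (hGm.comp_measurable (by fun_prop))
  refine ⟨hm.integral_prod_right'.aestronglyMeasurable, ?_⟩
  have h2 : (2 : ℝ≥0∞) ≠ 0 := by norm_num
  have h2' : (2 : ℝ≥0∞) ≠ ⊤ := by norm_num
  have hFt := lintegral_rpow_enorm_lt_top_of_eLpNorm_lt_top h2 h2' hF.2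
  have hGt := lintegral_rpow_enorm_lt_top_of_eLpNorm_lt_top h2 h2' hG.2
  refine (eLpNorm_lt_top_iff_lintegral_rpow_enorm_lt_top h2 h2').2 ?_
  have hFe : Measurable fun z : α × σ => ‖F z‖ₑ ^ (2 : ℝ≥0∞).toReal :=
    hFm.enorm.pow_const _
  have hGe : Measurable fun z : σ × β => ‖G z‖ₑ ^ (2 : ℝ≥0∞).toReal :=
    hGm.enorm.pow_const _
  have bound : ∀ z : α × β, ‖∫ s, F (z.1, s) * G (s, z.2) ∂ρ‖ₑ ^ (2 : ℝ≥0∞).toReal ≤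
      (∫⁻ s, ‖F (z.1, s)‖ₑ ^ (2 : ℝ≥0∞).toReal ∂ρ) *
        (∫⁻ s, ‖G (s, z.2)‖ₑ ^ (2 : ℝ≥0∞).toReal ∂ρ) := by
    intro z
    have hc := ENNReal.lintegral_mul_le_Lp_mul_Lq ρ (p := 2) (q := 2)
      (f := fun s => ‖F (z.1, s)‖ₑ) (g := fun s => ‖G (s, z.2)‖ₑ) Real.HolderConjugate.two_two
      ((hFm.comp_measurable (by fun_prop)).enorm.aemeasurable)
      ((hGm.comp_measurable (by fun_prop)).enorm.aemeasurable)
    calc _ ≤ (∫⁻ s, ‖F (z.1, s) * G (s, z.2)‖ₑ ∂ρ) ^ (2 : ℝ≥0∞).toReal :=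
          ENNReal.rpow_le_rpow (enorm_integral_le_lintegral_enorm _) (by norm_num)
      _ ≤ _ := by
          refine (ENNReal.rpow_le_rpow ((le_of_eq ?_).trans hc) (by norm_num)).trans (le_of_eq ?_)
          · exact lintegral_congr fun s => by simp [enorm_mul]
          · rw [ENNReal.mul_rpow_of_nonneg _ _ (by norm_num), ← ENNReal.rpow_mul,
              ← ENNReal.rpow_mul]
            simp
  refine (lintegral_mono bound).trans_lt ?_
  have e := lintegral_prod_mul (μ := μ) (ν := ν)
    (f := fun a => ∫⁻ s, ‖F (a, s)‖ₑ ^ (2 : ℝ≥0∞).toReal ∂ρ)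
    (g := fun b => ∫⁻ s, ‖G (s, b)‖ₑ ^ (2 : ℝ≥0∞).toReal ∂ρ)
    hFe.lintegral_prod_right'.aemeasurable hGe.lintegral_prod_left'.aemeasurable
  rw [e, ← lintegral_prod _ hFe.aemeasurable, ← lintegral_prod_symm _ hGe.aemeasurable]
  exact ENNReal.mul_lt_top hFt hGt

/-- Regrouping coordinates along a bijection of the indices. -/
theorem measurePreserving_regroup {a b c : ℕ} (e : Fin a ⊕ Fin b ≃ Fin c) :
    MeasurePreserving
      (fun z : (Fin a → ℝ) × (Fin b → ℝ) => fun k : Fin c => Sum.elim z.1 z.2 (e.symm k))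
      ((orthant a).prod (orthant b)) (orthant c) := by
  have h1 := measurePreserving_sumPiEquivProdPi_symm (X := fun _ : Fin a ⊕ Fin b => ℝ)
    (fun _ => halfLine)
  have h2 := measurePreserving_piCongrLeft (α := fun _ : Fin c => ℝ) (fun _ => halfLine) e
  have h3 := h2.comp h1
  convert! h3 using 1
  funext z k
  obtain ⟨x, rfl⟩ := e.surjective k
  cases x <;> simp [MeasurableEquiv.piCongrLeft, MeasurableEquiv.sumPiEquivProdPi]

theorem measurePreserving_ungroup {a b c : ℕ} (e : Fin a ⊕ Fin b ≃ Fin c) :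
    MeasurePreserving
      (fun t : Fin c → ℝ => ((fun i => t (e (Sum.inl i)), fun j => t (e (Sum.inr j))) :
        (Fin a → ℝ) × (Fin b → ℝ)))
      (orthant c) ((orthant a).prod (orthant b)) := by
  let E : ((Fin a → ℝ) × (Fin b → ℝ)) ≃ᵐ (Fin c → ℝ) :=
    { toFun := fun z k => Sum.elim z.1 z.2 (e.symm k)
      invFun := fun t => (fun i => t (e (Sum.inl i)), fun j => t (e (Sum.inr j)))
      left_inv := fun z => by simp
      right_inv := fun t => by
        funext k
        obtain ⟨x, rfl⟩ := e.surjective k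
        cases x <;> simp
      measurable_toFun := (measurePreserving_regroup e).measurable
      measurable_invFun := by
        show Measurable fun t : Fin c → ℝ =>
          ((fun i => t (e (Sum.inl i)), fun j => t (e (Sum.inr j))) : (Fin a → ℝ) × (Fin b → ℝ))
        fun_prop }
  exact MeasurePreserving.symm E (measurePreserving_regroup e)

theorem memLp_contractionFun {n m p : ℕ} (hn : p ≤ n) (hm : p ≤ m) (f : Kernel n)
    (g : Kernel m) : MemLp (contractionFun hn hm f g) 2 (orthant (n + m - 2 * p)) := by
  let φ₁ : Fin (n - p) ⊕ Fin p → Fin n :=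
    Sum.elim (fun i => ⟨i, by omega⟩) (fun j => ⟨n - 1 - j, by omega⟩)
  let φ₂ : Fin p ⊕ Fin (m - p) → Fin m :=
    Sum.elim (fun i => ⟨i, by omega⟩) (fun j => ⟨p + j, by omega⟩)
  let φ₃ : Fin (n - p) ⊕ Fin (m - p) → Fin (n + m - 2 * p) :=
    Sum.elim (fun i => ⟨i, by omega⟩) (fun j => ⟨n - p + j, by omega⟩)
  have i₁ : Function.Injective φ₁ := by
    rintro (i | i) (j | j) h <;> simp [φ₁, Fin.ext_iff] at h ⊢ <;> omega
  have i₂ : Function.Injective φ₂ := by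
    rintro (i | i) (j | j) h <;> simp [φ₂, Fin.ext_iff] at h ⊢ <;> omega
  have i₃ : Function.Injective φ₃ := by
    rintro (i | i) (j | j) h <;> simp [φ₃, Fin.ext_iff] at h ⊢ <;> omega
  let e₁ := Equiv.ofBijective φ₁ ((Fintype.bijective_iff_injective_and_card _).2
    ⟨i₁, by simp; omega⟩)
  let e₂ := Equiv.ofBijective φ₂ ((Fintype.bijective_iff_injective_and_card _).2
    ⟨i₂, by simp; omega⟩)
  let e₃ := Equiv.ofBijective φ₃ ((Fintype.bijective_iff_injective_and_card _).2
    ⟨i₃, by simp; omega⟩)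
  have m₁ := measurePreserving_regroup e₁
  have m₂ := measurePreserving_regroup e₂
  have key := (memLp_partial_integral
    ((Lp.stronglyMeasurable f).comp_measurable m₁.measurable)
    ((Lp.stronglyMeasurable g).comp_measurable m₂.measurable)
    ((Lp.memLp f).comp_measurePreserving m₁)
    ((Lp.memLp g).comp_measurePreserving m₂)).comp_measurePreserving
      (measurePreserving_ungroup e₃)
  refine (funext fun t => ?_ : _ = contractionFun hn hm f g) ▸ key
  refine integral_congr_ae (Eventually.of_forall fun s => ?_)
  have l : (fun k => Sum.elim (fun i => t (e₃ (Sum.inl i))) s (e₁.symm k)) = leftArg hn hm t s := by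
    funext k
    obtain ⟨x, rfl⟩ := e₁.surjective k
    rw [Equiv.symm_apply_apply]
    cases x with
    | inl i => simp [leftArg, e₁, φ₁, e₃, φ₃]
    | inr j =>
      have h1 : ¬ (n - 1 - (j : ℕ) < n - p) := by omega
      have h2 : n - 1 - (n - 1 - (j : ℕ)) = j := by omega
      simp [leftArg, e₁, φ₁, h1, h2]
  have r : (fun k => Sum.elim s (fun j => t (e₃ (Sum.inr j))) (e₂.symm k))
      = rightArg hn hm t s := by
    funext k
    obtain ⟨x, rfl⟩ := e₂.surjective k
    rw [Equiv.symm_apply_apply]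
    cases x with
    | inl i => simp [rightArg, e₂, φ₂]
    | inr j => simp [rightArg, e₂, φ₂, e₃, φ₃]
  simp only [Function.comp_apply]
  rw [l, r]

/-- The nested contraction of order `p` of `f` and `g`, as an element of `L²(ℝ₊^{n+m-2p})`. -/
def contraction {n m : ℕ} (p : ℕ) (hn : p ≤ n) (hm : p ≤ m) (f : Kernel n) (g : Kernel m) :
    Kernel (n + m - 2 * p) :=
  (memLp_contractionFun hn hm f g).toLp _

end Wigner

end

noncomputable section

namespace Wigner

/-! The integral has a closed form on Fock space: `Iₙ(f) = ∑ₚ Cₚ(f)` over `0 ≤ p ≤ n`, where `Cₚ(f)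
ξ = f ⌢ᵖ ξ` (`contractWith`). Cauchy–Schwarz gives `‖f ⌢ᵖ g‖ ≤ ‖f‖ ‖g‖`. Each `Cₚ(f)` maps different
degrees to different degrees, so `‖Cₚ(f)‖ ≤ ‖f‖`; hence the sum, `integralL`, is continuous in `f`
for the operator norm.

For an off-diagonal rectangle the sides are disjoint intervals `Jᵢ`. In the expansion of `∏
(l(1_{Jᵢ}) + l*(1_{Jᵢ}))` every word with an annihilator directly left of a creator vanishes,
because `l*(h) l(a) = ⟨h, a⟩`. The surviving words are creators followed by `p` annihilators, and
such a word is `Cₚ(1_A)`. So `integralL` agrees with the prescribed value on rectangles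
(`integralL_rectangle`). Rectangles are total in `L²(ℝ₊ⁿ)` since the diagonals are null.

Only `p = 0` survives on the vacuum, so `Iₙ(f) Ω = f` (`integralL_vacuum`) and `L²(τ)`-convergence
of integrals is convergence of kernels. The vacuum is separating for the algebra
(`eq_zero_of_vacuum_eq_zero`): reversing the arguments turns left semicircular operators into right
ones, which commute with the left ones and generate a dense subspace from `Ω`. This gives uniqueness
(`isWignerIntegral_iff`). It also reduces the product formula to an identity of vectors: `Iₙ(f)
Iₘ(g) Ω = Iₙ(f) g = ∑ₚ f ⌢ᵖ g`. -/

/-! ### Density of off-diagonal rectangles -/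

/-- An integrable function on `ℝⁿ` whose integrals over all boxes vanish is zero. -/
theorem ae_eq_zero_of_forall_setIntegral_Icc_eq_zero {n : ℕ} {μ : Measure (Fin n → ℝ)}
    {f : (Fin n → ℝ) → ℂ} (hf : Integrable f μ) (huniv : ∫ t, f t ∂μ = 0)
    (hbox : ∀ u v : Fin n → ℝ, ∫ t in Set.Icc u v, f t ∂μ = 0) : f =ᵐ[μ] 0 := by
  refine hf.ae_eq_zero_of_forall_setIntegral_eq_zero fun s hs _ => ?_
  have hreal : MeasurableSpace.generateFrom
      {S : Set ℝ | ∃ l ∈ Set.univ, ∃ u ∈ Set.univ, l ≤ u ∧ Set.Icc l u = S} =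
      (inferInstance : MeasurableSpace ℝ) := by
    rw [← Dense.borel_eq_generateFrom_Icc_mem_aux dense_univ (by simp) (by simp)]
    exact (BorelSpace.measurable_eq (α := ℝ)).symm
  have hspan : IsCountablySpanning
      {S : Set ℝ | ∃ l ∈ Set.univ, ∃ u ∈ Set.univ, l ≤ u ∧ Set.Icc l u = S} := by
    refine ⟨fun k : ℕ => Set.Icc (-(k : ℝ)) k,
      fun k => ⟨_, trivial, _, trivial, by linarith [k.cast_nonneg (α := ℝ)], rfl⟩, ?_⟩
    refine Set.eq_univ_of_forall fun x => ?_
    obtain ⟨k, hk⟩ := exists_nat_ge |x|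
    exact Set.mem_iUnion.2 ⟨k, abs_le.1 hk⟩
  have hgen := generateFrom_eq_pi (ι := Fin n) (α := fun _ => ℝ) (fun _ => hreal) (fun _ => hspan)
  -- Boxes form a π-system generating the Borel sets; `huniv` is what passes the property to
  -- complements.
  refine MeasurableSpace.induction_on_inter (C := fun s _ => ∫ t in s, f t ∂μ = 0) hgen.symm
    (IsPiSystem.pi fun _ => isPiSystem_Icc_mem _ _) (by simp) ?_ ?_ ?_ s hs
  · rintro _ ⟨S, hS, rfl⟩
    choose l _ u _ _ h using fun i => hS i trivial
    have : Set.univ.pi S = Set.Icc l u := by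
      rw [← Set.pi_univ_Icc]
      exact congrArg _ (funext fun i => (h i).symm)
    rw [this]
    exact hbox l u
  · intro t ht h
    rw [setIntegral_compl ht hf, huniv, h, sub_zero]
  · intro S hd hS h
    rw [integral_iUnion hS hd hf.integrableOn]
    simp [h]

theorem orthant_eq_restrict (n : ℕ) :
    orthant n = (volume : Measure (Fin n → ℝ)).restrict (Set.univ.pi fun _ => Set.Ici 0) := by
  rw [volume_pi, Measure.restrict_pi_pi]
  rfl

theorem ae_nonneg (n : ℕ) : ∀ᵐ t ∂orthant n, ∀ i, 0 ≤ t i := by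
  rw [orthant_eq_restrict]
  filter_upwards [ae_restrict_mem (MeasurableSet.univ_pi fun _ => measurableSet_Ici)] with t ht i
  exact ht i trivial

theorem diagonals_eq_iUnion (n : ℕ) :
    diagonals n = ⋃ (i : Fin n) (j : Fin n) (_ : i ≠ j), {t : Fin n → ℝ | t i = t j} := by
  ext t
  simp [diagonals]

theorem isClosed_diagonals (n : ℕ) : IsClosed (diagonals n) := by
  rw [diagonals_eq_iUnion]
  refine isClosed_iUnion_of_finite fun i => isClosed_iUnion_of_finite fun j =>
    isClosed_iUnion_of_finite fun _ => isClosed_eq (continuous_apply i) (continuous_apply j)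

theorem orthant_diagonals (n : ℕ) : orthant n (diagonals n) = 0 := by
  rw [diagonals_eq_iUnion]
  refine measure_iUnion_null fun i => measure_iUnion_null fun j => measure_iUnion_null fun hij => ?_
  rw [orthant_eq_restrict]
  refine le_antisymm ((Measure.restrict_apply_le _ _).trans (le_of_eq ?_)) (zero_le)
  let V : Submodule ℝ (Fin n → ℝ) :=
    LinearMap.ker (LinearMap.proj (R := ℝ) (φ := fun _ : Fin n => ℝ) i - LinearMap.proj j)
  have hV : (V : Set (Fin n → ℝ)) = {t | t i = t j} := by
    ext t
    simp [V, sub_eq_zero]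
  rw [← hV]
  refine Measure.addHaar_submodule _ _ fun h => ?_
  have h1 : (Pi.single i (1 : ℝ) : Fin n → ℝ) ∈ V := h ▸ Submodule.mem_top
  simp [V, hij.symm] at h1

theorem inner_rectangle_kernel {n : ℕ} (A : Rectangle n) (f : Kernel n) :
    inner ℂ A.kernel f = ∫ t in Set.Icc A.lower A.upper, f t ∂orthant n :=
  L2.inner_indicatorConstLp_one _ _ f

/-- Sub-boxes of an off-diagonal rectangle are again off-diagonal, so the box criterion applies
inside each rectangle. Every off-diagonal point of the orthant has a relative neighbourhood that is
contained in such a rectangle, and the diagonals are null. -/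
theorem eq_zero_of_forall_inner_rectangle_eq_zero {n : ℕ} (f : Kernel n)
    (hf : ∀ A : Rectangle n, inner ℂ A.kernel f = 0) : f = 0 := by
  have hR : ∀ A : Rectangle n, ∀ᵐ t ∂(orthant n).restrict (Set.Icc A.lower A.upper), f t = 0 := by
    intro A
    refine ae_eq_zero_of_forall_setIntegral_Icc_eq_zero
      (integrableOn_Lp_of_measure_ne_top f (by norm_num) (orthant_Icc_ne_top _ _)) ?_ ?_
    · rw [← inner_rectangle_kernel, hf]
    · intro u v
      rw [Measure.restrict_restrict measurableSet_Icc, Set.Icc_inter_Icc]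
      by_cases h : u ⊔ A.lower ≤ v ⊓ A.upper
      · exact (inner_rectangle_kernel ⟨u ⊔ A.lower, v ⊓ A.upper,
          fun i => (A.lower_nonneg i).trans le_sup_right, h,
          A.off_diagonal.mono_left (Set.Icc_subset_Icc le_sup_right inf_le_right)⟩ f).symm.trans
          (hf _)
      · rw [Set.Icc_eq_empty h]
        simp
  have hnull : orthant n {t | f t ≠ 0 ∧ (∀ i, 0 ≤ t i) ∧ t ∉ diagonals n} = 0 := by
    refine measure_null_of_locally_null _ fun x hx => ?_
    obtain ⟨-, hx0, hxd⟩ := hx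
    obtain ⟨ε, hε, hball⟩ := Metric.isOpen_iff.1 (isClosed_diagonals n).isOpen_compl x hxd
    -- The closed sup-norm ball of radius `ε / 2` about `x`, cut at `0` to stay in the orthant. Half
    -- the radius puts this closed box in the open ball that avoids the diagonals.
    let A : Rectangle n :=
      { lower := fun i => max 0 (x i - ε / 2)
        upper := fun i => x i + ε / 2
        lower_nonneg := fun i => le_max_left _ _
        lower_le_upper := fun i => max_le (by linarith [hx0 i]) (by linarith)
        off_diagonal := by
          refine Set.disjoint_left.2 fun t ht => hball ?_
          refine lt_of_le_of_lt ((dist_pi_le_iff (half_pos hε).le).2 fun i => ?_) (half_lt_self hε)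
          have h1 := (le_max_right _ _).trans (ht.1 i)
          have h2 := ht.2 i
          rw [Real.dist_eq, abs_le]
          constructor <;> linarith }
    refine ⟨Set.Icc A.lower A.upper ∩ {t | f t ≠ 0}, ?_, ?_⟩
    · rw [mem_nhdsWithin]
      refine ⟨Metric.ball x (ε / 2), Metric.isOpen_ball, Metric.mem_ball_self (half_pos hε), ?_⟩
      rintro t ⟨ht, ht1, ht0, -⟩
      have h1 : ∀ i, |t i - x i| < ε / 2 := fun i => (dist_le_pi_dist t x i).trans_lt ht
      exact ⟨⟨fun i => max_le (ht0 i) (by linarith [(abs_lt.1 (h1 i)).1]),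
        fun i => show t i ≤ x i + ε / 2 by linarith [(abs_lt.1 (h1 i)).2]⟩, ht1⟩
    · have := hR A
      rw [ae_iff, Measure.restrict_apply₀' measurableSet_Icc.nullMeasurableSet] at this
      rwa [Set.inter_comm]
  refine (Lp.eq_zero_iff_ae_eq_zero).2 ?_
  have hd : ∀ᵐ t ∂orthant n, t ∉ diagonals n := measure_eq_zero_iff_ae_notMem.1 (orthant_diagonals n)
  have hn : ∀ᵐ t ∂orthant n, ¬ (f t ≠ 0 ∧ (∀ i, 0 ≤ t i) ∧ t ∉ diagonals n) :=
    measure_eq_zero_iff_ae_notMem.1 hnull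
  filter_upwards [hd, hn, ae_nonneg n] with t h1 h2 h3
  by_contra h
  exact h2 ⟨h, h3, h1⟩

theorem topologicalClosure_span_rectangle (n : ℕ) :
    (Submodule.span ℂ (Set.range (Rectangle.kernel (n := n)))).topologicalClosure = ⊤ := by
  rw [Submodule.topologicalClosure_eq_top_iff, Submodule.eq_bot_iff]
  intro f hf
  refine eq_zero_of_forall_inner_rectangle_eq_zero f fun A => ?_
  exact (Submodule.mem_orthogonal _ _).1 hf _ (Submodule.subset_span ⟨A, rfl⟩)

/-- Continuous linear maps that agree on the indicators of rectangles are equal. -/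
theorem kernel_ext {n : ℕ} {E : Type*} [AddCommGroup E] [Module ℂ E] [TopologicalSpace E]
    [T2Space E] {S T : Kernel n →L[ℂ] E} (h : ∀ A : Rectangle n, S A.kernel = T A.kernel) :
    S = T := by
  refine ContinuousLinearMap.ext_on (s := Set.range (Rectangle.kernel (n := n))) ?_ ?_
  · exact Submodule.dense_iff_topologicalClosure_eq_top.2 (topologicalClosure_span_rectangle n)
  · rintro _ ⟨A, rfl⟩
    exact h A

theorem exists_simple_tendsto {n : ℕ} (f : Kernel n) :
    ∃ φ : ℕ → Simple n, Tendsto (fun k => (φ k).kernel) atTop (𝓝 f) := by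
  have hf : f ∈ closure (Submodule.span ℂ (Set.range (Rectangle.kernel (n := n))) :
      Set (Kernel n)) := by
    rw [← Submodule.topologicalClosure_coe, topologicalClosure_span_rectangle]
    trivial
  obtain ⟨x, hx, hlim⟩ := mem_closure_iff_seq_limit.1 hf
  choose φ hφ using fun k => (Finsupp.mem_span_range_iff_exists_finsupp).1 (hx k)
  exact ⟨φ, by simpa only [Simple.kernel, hφ] using hlim⟩

/-- Continuous linear maps on Fock space that agree on the indicators of rectangles are equal. -/
theorem fock_ext {E : Type*} [AddCommGroup E] [Module ℂ E] [TopologicalSpace E]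
    [T2Space E] {S T : Fock →L[ℂ] E}
    (h : ∀ n (A : Rectangle n), S (lp.single 2 n A.kernel) = T (lp.single 2 n A.kernel)) :
    S = T :=
  lp.ext_continuousLinearMap (by norm_num) fun n => kernel_ext fun A => h n A

/-! ### Cauchy–Schwarz for partial integrals -/

section PartialIntegral

variable {α β σ : Type*} [MeasurableSpace α] [MeasurableSpace β] [MeasurableSpace σ]
  {μ : Measure α} {ν : Measure β} {ρ : Measure σ} [SFinite ν] [SFinite ρ]

/-- Cauchy–Schwarz in `s` for fixed outer variables, then Tonelli splits the product of the two
remaining integrals. The constant `1` is what makes contractions norm-decreasing. -/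
theorem eLpNorm_partial_integral_le {F : α × σ → ℂ} {G : σ × β → ℂ} (hFm : StronglyMeasurable F)
    (hGm : StronglyMeasurable G) :
    eLpNorm (fun z : α × β => ∫ s, F (z.1, s) * G (s, z.2) ∂ρ) 2 (μ.prod ν) ≤
      eLpNorm F 2 (μ.prod ρ) * eLpNorm G 2 (ρ.prod ν) := by
  have h2 : (2 : ℝ≥0∞) ≠ 0 := by norm_num
  have h2' : (2 : ℝ≥0∞) ≠ ⊤ := by norm_num
  have hFe : Measurable fun z : α × σ => ‖F z‖ₑ ^ (2 : ℝ≥0∞).toReal := hFm.enorm.pow_const _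
  have hGe : Measurable fun z : σ × β => ‖G z‖ₑ ^ (2 : ℝ≥0∞).toReal := hGm.enorm.pow_const _
  have bound : ∀ z : α × β, ‖∫ s, F (z.1, s) * G (s, z.2) ∂ρ‖ₑ ^ (2 : ℝ≥0∞).toReal ≤
      (∫⁻ s, ‖F (z.1, s)‖ₑ ^ (2 : ℝ≥0∞).toReal ∂ρ) *
        (∫⁻ s, ‖G (s, z.2)‖ₑ ^ (2 : ℝ≥0∞).toReal ∂ρ) := by
    intro z
    have hc := ENNReal.lintegral_mul_le_Lp_mul_Lq ρ (p := 2) (q := 2)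
      (f := fun s => ‖F (z.1, s)‖ₑ) (g := fun s => ‖G (s, z.2)‖ₑ) Real.HolderConjugate.two_two
      ((hFm.comp_measurable (by fun_prop)).enorm.aemeasurable)
      ((hGm.comp_measurable (by fun_prop)).enorm.aemeasurable)
    calc _ ≤ (∫⁻ s, ‖F (z.1, s) * G (s, z.2)‖ₑ ∂ρ) ^ (2 : ℝ≥0∞).toReal :=
          ENNReal.rpow_le_rpow (enorm_integral_le_lintegral_enorm _) (by norm_num)
      _ ≤ _ := by
          refine (ENNReal.rpow_le_rpow ((le_of_eq ?_).trans hc) (by norm_num)).trans (le_of_eq ?_)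
          · exact lintegral_congr fun s => by simp [enorm_mul]
          · rw [ENNReal.mul_rpow_of_nonneg _ _ (by norm_num), ← ENNReal.rpow_mul,
              ← ENNReal.rpow_mul]
            simp
  have e := lintegral_prod_mul (μ := μ) (ν := ν)
    (f := fun a => ∫⁻ s, ‖F (a, s)‖ₑ ^ (2 : ℝ≥0∞).toReal ∂ρ)
    (g := fun b => ∫⁻ s, ‖G (s, b)‖ₑ ^ (2 : ℝ≥0∞).toReal ∂ρ)
    hFe.lintegral_prod_right'.aemeasurable hGe.lintegral_prod_left'.aemeasurable
  rw [← lintegral_prod _ hFe.aemeasurable, ← lintegral_prod_symm _ hGe.aemeasurable] at e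
  rw [eLpNorm_eq_lintegral_rpow_enorm_toReal h2 h2', eLpNorm_eq_lintegral_rpow_enorm_toReal h2 h2',
    eLpNorm_eq_lintegral_rpow_enorm_toReal h2 h2', ← ENNReal.mul_rpow_of_nonneg _ _ (by norm_num),
    ← e]
  exact ENNReal.rpow_le_rpow (lintegral_mono bound) (by norm_num)

theorem ae_memLp_section {F : α × σ → ℂ} (hFm : StronglyMeasurable F)
    (hF : MemLp F 2 (μ.prod ρ)) : ∀ᵐ a ∂μ, MemLp (fun s => F (a, s)) 2 ρ := by
  have h2 : (2 : ℝ≥0∞) ≠ 0 := by norm_num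
  have h2' : (2 : ℝ≥0∞) ≠ ⊤ := by norm_num
  have hFt := lintegral_rpow_enorm_lt_top_of_eLpNorm_lt_top h2 h2' hF.2
  have hFe : Measurable fun z : α × σ => ‖F z‖ₑ ^ (2 : ℝ≥0∞).toReal := hFm.enorm.pow_const _
  rw [lintegral_prod _ hFe.aemeasurable] at hFt
  filter_upwards [ae_lt_top hFe.lintegral_prod_right' hFt.ne] with a ha
  exact ⟨(hFm.comp_measurable (by fun_prop)).aestronglyMeasurable,
    (eLpNorm_lt_top_iff_lintegral_rpow_enorm_lt_top h2 h2').2 ha⟩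

/-- Almost every section of a square-integrable function is square integrable. Additivity of
contractions needs this integrability, as the integral is additive only for integrable functions. -/
theorem ae_integrable_partial [SFinite μ] {F : α × σ → ℂ} {G : σ × β → ℂ} (hFm : StronglyMeasurable F)
    (hGm : StronglyMeasurable G) (hF : MemLp F 2 (μ.prod ρ)) (hG : MemLp G 2 (ρ.prod ν)) :
    ∀ᵐ z ∂μ.prod ν, Integrable (fun s => F (z.1, s) * G (s, z.2)) ρ := by
  have h1 := Measure.quasiMeasurePreserving_fst (μ := μ) (ν := ν) |>.ae (ae_memLp_section hFm hF)
  have h2 := Measure.quasiMeasurePreserving_snd (μ := μ) (ν := ν) |>.ae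
    (ae_memLp_section (hGm.comp_measurable measurable_swap)
      (hG.comp_measurePreserving Measure.measurePreserving_swap))
  filter_upwards [h1, h2] with z hz1 hz2
  exact MemLp.integrable_mul hz1 hz2

theorem ae_partial_of_ae {P : α × σ → Prop} {Q : σ × β → Prop} (hP : ∀ᵐ w ∂μ.prod ρ, P w)
    (hQ : ∀ᵐ w ∂ρ.prod ν, Q w) :
    ∀ᵐ z ∂μ.prod ν, ∀ᵐ s ∂ρ, P (z.1, s) ∧ Q (s, z.2) := by
  have h1 := Measure.quasiMeasurePreserving_fst (μ := μ) (ν := ν) |>.ae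
    (Measure.ae_ae_of_ae_prod hP)
  have h2 := Measure.quasiMeasurePreserving_snd (μ := μ) (ν := ν) |>.ae
    (Measure.ae_ae_of_ae_prod
      ((Measure.measurePreserving_swap (μ := ν) (ν := ρ)).quasiMeasurePreserving.ae hQ))
  filter_upwards [h1, h2] with z hz1 hz2
  exact hz1.and hz2

end PartialIntegral

/-! ### Nested contractions as bounded bilinear maps -/

/-- The arities `n` and `m` allow a contraction of order `p`, and the result has arity `c`. -/
structure Fits (n m p c : ℕ) : Prop where
  left : p ≤ n
  right : p ≤ m
  total : c + 2 * p = n + m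

/-- In `Fits` the resulting arity `c` is a free variable; this avoids transporting kernels along
equalities of natural numbers. -/
theorem Fits.eq {n m p c : ℕ} (h : Fits n m p c) : c = n + m - 2 * p := by
  have := h.total
  omega

variable {n m p c : ℕ}

/-- The first argument `(t₁, …, t_{n-p}, s_p, …, s₁)` in a contraction. -/
def fstArg (h : Fits n m p c) (t : Fin c → ℝ) (s : Fin p → ℝ) : Fin n → ℝ :=
  fun i => if hi : (i : ℕ) < n - p then t ⟨i, by obtain ⟨_, _, _⟩ := h; omega⟩
    else s ⟨n - 1 - i, by omega⟩

/-- The second argument `(s₁, …, s_p, t_{n-p+1}, …)` in a contraction. -/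
def sndArg (h : Fits n m p c) (t : Fin c → ℝ) (s : Fin p → ℝ) : Fin m → ℝ :=
  fun j => if hj : (j : ℕ) < p then s ⟨j, hj⟩
    else t ⟨n - p + (j - p), by obtain ⟨_, _, _⟩ := h; omega⟩

/-- Permuting coordinates preserves the product measure, so a nested contraction becomes a plain
partial integral. The reversal of `s` is absorbed in `φ₁`. -/
theorem exists_measurePreserving_args (h : Fits n m p c) :
    ∃ (φ₁ : (Fin (n - p) → ℝ) × (Fin p → ℝ) → Fin n → ℝ)
      (φ₂ : (Fin p → ℝ) × (Fin (m - p) → ℝ) → Fin m → ℝ)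
      (φ₃ : (Fin c → ℝ) → (Fin (n - p) → ℝ) × (Fin (m - p) → ℝ)),
      MeasurePreserving φ₁ ((orthant (n - p)).prod (orthant p)) (orthant n) ∧
      MeasurePreserving φ₂ ((orthant p).prod (orthant (m - p))) (orthant m) ∧
      MeasurePreserving φ₃ (orthant c) ((orthant (n - p)).prod (orthant (m - p))) ∧
      (∀ t s, fstArg h t s = φ₁ ((φ₃ t).1, s)) ∧ ∀ t s, sndArg h t s = φ₂ (s, (φ₃ t).2) := by
  obtain ⟨hn, hm, hc⟩ := id h
  let φ₁ : Fin (n - p) ⊕ Fin p → Fin n :=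
    Sum.elim (fun i => ⟨i, by omega⟩) (fun j => ⟨n - 1 - j, by omega⟩)
  let φ₂ : Fin p ⊕ Fin (m - p) → Fin m :=
    Sum.elim (fun i => ⟨i, by omega⟩) (fun j => ⟨p + j, by omega⟩)
  let φ₃ : Fin (n - p) ⊕ Fin (m - p) → Fin c :=
    Sum.elim (fun i => ⟨i, by omega⟩) (fun j => ⟨n - p + j, by omega⟩)
  have i₁ : Function.Injective φ₁ := by
    rintro (i | i) (j | j) h <;> simp [φ₁, Fin.ext_iff] at h ⊢ <;> omega
  have i₂ : Function.Injective φ₂ := by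
    rintro (i | i) (j | j) h <;> simp [φ₂, Fin.ext_iff] at h ⊢ <;> omega
  have i₃ : Function.Injective φ₃ := by
    rintro (i | i) (j | j) h <;> simp [φ₃, Fin.ext_iff] at h ⊢ <;> omega
  let e₁ := Equiv.ofBijective φ₁ ((Fintype.bijective_iff_injective_and_card _).2
    ⟨i₁, by simp; omega⟩)
  let e₂ := Equiv.ofBijective φ₂ ((Fintype.bijective_iff_injective_and_card _).2
    ⟨i₂, by simp; omega⟩)
  let e₃ := Equiv.ofBijective φ₃ ((Fintype.bijective_iff_injective_and_card _).2
    ⟨i₃, by simp; omega⟩)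
  refine ⟨_, _, _, measurePreserving_regroup e₁, measurePreserving_regroup e₂,
    measurePreserving_ungroup e₃, fun t s => ?_, fun t s => ?_⟩
  · funext k
    obtain ⟨x, rfl⟩ := e₁.surjective k
    simp only [Equiv.symm_apply_apply]
    cases x with
    | inl i => simp [fstArg, e₁, φ₁, e₃, φ₃]
    | inr j =>
      have h1 : ¬ (n - 1 - (j : ℕ) < n - p) := by omega
      have h2 : n - 1 - (n - 1 - (j : ℕ)) = j := by omega
      simp [fstArg, e₁, φ₁, h1, h2]
  · funext k
    obtain ⟨x, rfl⟩ := e₂.surjective k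
    simp only [Equiv.symm_apply_apply]
    cases x with
    | inl i => simp [sndArg, e₂, φ₂]
    | inr j => simp [sndArg, e₂, φ₂, e₃, φ₃]

/-- The nested contraction of two functions. -/
def contrFun (h : Fits n m p c) (f : (Fin n → ℝ) → ℂ) (g : (Fin m → ℝ) → ℂ) :
    (Fin c → ℝ) → ℂ :=
  fun t => ∫ s, f (fstArg h t s) * g (sndArg h t s) ∂orthant p

theorem ae_ae_args (h : Fits n m p c) {P : (Fin n → ℝ) → Prop} {Q : (Fin m → ℝ) → Prop}
    (hP : ∀ᵐ x ∂orthant n, P x) (hQ : ∀ᵐ x ∂orthant m, Q x) :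
    ∀ᵐ t ∂orthant c, ∀ᵐ s ∂orthant p, P (fstArg h t s) ∧ Q (sndArg h t s) := by
  obtain ⟨φ₁, φ₂, φ₃, m₁, m₂, m₃, h₁, h₂⟩ := exists_measurePreserving_args h
  simp only [h₁, h₂]
  exact m₃.quasiMeasurePreserving.ae (ae_partial_of_ae (m₁.quasiMeasurePreserving.ae hP)
    (m₂.quasiMeasurePreserving.ae hQ))

theorem contrFun_congr (h : Fits n m p c) {f f' : (Fin n → ℝ) → ℂ} {g g' : (Fin m → ℝ) → ℂ}
    (hf : f =ᵐ[orthant n] f') (hg : g =ᵐ[orthant m] g') :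
    contrFun h f g =ᵐ[orthant c] contrFun h f' g' := by
  filter_upwards [ae_ae_args h hf hg] with t ht
  refine integral_congr_ae ?_
  filter_upwards [ht] with s hs
  rw [hs.1, hs.2]

theorem ae_integrable_contr (h : Fits n m p c) (f : Kernel n) (g : Kernel m) :
    ∀ᵐ t ∂orthant c, Integrable (fun s => f (fstArg h t s) * g (sndArg h t s)) (orthant p) := by
  obtain ⟨φ₁, φ₂, φ₃, m₁, m₂, m₃, h₁, h₂⟩ := exists_measurePreserving_args h
  simp only [h₁, h₂]
  exact m₃.quasiMeasurePreserving.ae (ae_integrable_partial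
    ((Lp.stronglyMeasurable f).comp_measurable m₁.measurable)
    ((Lp.stronglyMeasurable g).comp_measurable m₂.measurable)
    ((Lp.memLp f).comp_measurePreserving m₁) ((Lp.memLp g).comp_measurePreserving m₂))

theorem memLp_contrFun (h : Fits n m p c) (f : Kernel n) (g : Kernel m) :
    MemLp (contrFun h f g) 2 (orthant c) := by
  obtain rfl := h.eq
  exact memLp_contractionFun h.left h.right f g

theorem eLpNorm_contrFun_le (h : Fits n m p c) (f : Kernel n) (g : Kernel m) :
    eLpNorm (contrFun h f g) 2 (orthant c) ≤
      eLpNorm f 2 (orthant n) * eLpNorm g 2 (orthant m) := by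
  obtain ⟨φ₁, φ₂, φ₃, m₁, m₂, m₃, h₁, h₂⟩ := exists_measurePreserving_args h
  have hF := (Lp.stronglyMeasurable f).comp_measurable m₁.measurable
  have hG := (Lp.stronglyMeasurable g).comp_measurable m₂.measurable
  have key := eLpNorm_partial_integral_le (μ := orthant (n - p)) (ν := orthant (m - p))
    (ρ := orthant p) hF hG
  rw [eLpNorm_comp_measurePreserving (Lp.aestronglyMeasurable f) m₁,
    eLpNorm_comp_measurePreserving (Lp.aestronglyMeasurable g) m₂] at key
  rw [← eLpNorm_comp_measurePreserving (memLp_partial_integral hF hG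
    ((Lp.memLp f).comp_measurePreserving m₁) ((Lp.memLp g).comp_measurePreserving m₂)).1 m₃] at key
  refine le_trans (le_of_eq ?_) key
  congr 1
  funext t
  simp only [contrFun, h₁, h₂]
  rfl

theorem norm_toLp_contrFun_le (h : Fits n m p c) (f : Kernel n) (g : Kernel m) :
    ‖(memLp_contrFun h f g).toLp _‖ ≤ ‖f‖ * ‖g‖ := by
  rw [Lp.norm_toLp, Lp.norm_def, Lp.norm_def, ← ENNReal.toReal_mul]
  exact ENNReal.toReal_mono (ENNReal.mul_ne_top (Lp.eLpNorm_ne_top f) (Lp.eLpNorm_ne_top g))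
    (eLpNorm_contrFun_le h f g)

/-- The nested contraction as a bounded bilinear map. -/
def contr (h : Fits n m p c) : Kernel n →L[ℂ] Kernel m →L[ℂ] Kernel c :=
  LinearMap.mkContinuous₂
    (LinearMap.mk₂ ℂ (fun f g => (memLp_contrFun h f g).toLp _)
      (fun f f' g => by
        refine Eq.trans ?_ (MemLp.toLp_add _ _)
        refine (MemLp.toLp_eq_toLp_iff _ _).2 ?_
        filter_upwards [contrFun_congr h (Lp.coeFn_add f f') (ae_eq_refl g),
          ae_integrable_contr h f g, ae_integrable_contr h f' g] with t ht h1 h2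
        refine ht.trans (Eq.trans ?_ (integral_add h1 h2))
        exact integral_congr_ae (Eventually.of_forall fun s => add_mul _ _ _))
      (fun a f g => by
        refine Eq.trans ?_ (MemLp.toLp_const_smul a (memLp_contrFun h f g))
        refine (MemLp.toLp_eq_toLp_iff _ _).2 ?_
        filter_upwards [contrFun_congr h (Lp.coeFn_smul a f) (ae_eq_refl g)] with t ht
        refine ht.trans (Eq.trans ?_ (integral_const_mul a _))
        exact integral_congr_ae (Eventually.of_forall fun s => mul_assoc _ _ _))
      (fun f g g' => by
        refine Eq.trans ?_ (MemLp.toLp_add _ _)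
        refine (MemLp.toLp_eq_toLp_iff _ _).2 ?_
        filter_upwards [contrFun_congr h (ae_eq_refl f) (Lp.coeFn_add g g'),
          ae_integrable_contr h f g, ae_integrable_contr h f g'] with t ht h1 h2
        refine ht.trans (Eq.trans ?_ (integral_add h1 h2))
        exact integral_congr_ae (Eventually.of_forall fun s => mul_add _ _ _))
      (fun a f g => by
        refine Eq.trans ?_ (MemLp.toLp_const_smul a (memLp_contrFun h f g))
        refine (MemLp.toLp_eq_toLp_iff _ _).2 ?_
        filter_upwards [contrFun_congr h (ae_eq_refl f) (Lp.coeFn_smul a g)] with t ht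
        refine ht.trans (Eq.trans ?_ (integral_const_mul a _))
        exact integral_congr_ae (Eventually.of_forall fun s => mul_left_comm _ _ _)))
    1
    (fun f g => by
      rw [one_mul]
      exact norm_toLp_contrFun_le h f g)

theorem norm_contr_le (h : Fits n m p c) (f : Kernel n) (g : Kernel m) :
    ‖contr h f g‖ ≤ ‖f‖ * ‖g‖ :=
  norm_toLp_contrFun_le h f g

theorem coeFn_prepend (a : OneParticle) (f : Kernel n) :
    prepend a f =ᵐ[orthant (n + 1)] fun t => a (t 0) * f (fun i => t i.succ) :=
  MemLp.coeFn_toLp _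

/-- Moving the last factor of the left argument to the front of the right argument. -/
theorem contr_zero_append {f : Kernel n} {k : OneParticle} {F : Kernel (n + 1)}
    (hF : F =ᵐ[orthant (n + 1)] fun t => f (fun i => t i.castSucc) * k (t (Fin.last n)))
    (h : Fits (n + 1) m 0 c) (h' : Fits n (m + 1) 0 c) (g : Kernel m) :
    contr h F g = contr h' f (prepend k g) := by
  refine (MemLp.toLp_eq_toLp_iff (memLp_contrFun h _ _) (memLp_contrFun h' _ _)).2 ?_
  refine (contrFun_congr h hF (ae_eq_refl g)).trans
    (EventuallyEq.trans ?_ (contrFun_congr h' (ae_eq_refl f) (coeFn_prepend k g)).symm)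
  refine Eventually.of_forall fun t => integral_congr_ae (Eventually.of_forall fun s => ?_)
  have h1 : (fun i : Fin n => fstArg h t s i.castSucc) = fstArg h' t s := by
    funext i
    have : (i : ℕ) < n + 1 := by omega
    simp [fstArg, this]
  have h2 : fstArg h t s (Fin.last n) = sndArg h' t s 0 := by simp [fstArg, sndArg]
  have h3 : (fun i : Fin m => sndArg h' t s i.succ) = sndArg h t s := by
    funext i
    simp only [sndArg, Fin.val_succ]
    simp [Nat.add_assoc, Nat.add_comm 1]
  simp only [h1, h2, h3, mul_assoc]

/-- Contracting a last factor against a first factor. -/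
theorem contr_succ_append_prepend {f : Kernel n} {k : OneParticle} {F : Kernel (n + 1)}
    (hF : F =ᵐ[orthant (n + 1)] fun t => f (fun i => t i.castSucc) * k (t (Fin.last n)))
    (h : Fits (n + 1) (m + 1) (p + 1) c) (h' : Fits n m p c) (a : OneParticle) (g : Kernel m) :
    contr h F (prepend a g) = (∫ x, k x * a x ∂halfLine) • contr h' f g := by
  refine Eq.trans ?_ (MemLp.toLp_const_smul (∫ x, k x * a x ∂halfLine) (memLp_contrFun h' f g))
  refine (MemLp.toLp_eq_toLp_iff (memLp_contrFun h _ _)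
    ((memLp_contrFun h' f g).const_smul _)).2 ?_
  refine (contrFun_congr h hF (coeFn_prepend a g)).trans (Eventually.of_forall fun t => ?_)
  -- Nesting makes the last argument of `F` and the first argument of the right factor the same
  -- variable `s 0`. Fubini splits it off and leaves a contraction of order `p`.
  have key := integral_prod_mul (μ := halfLine) (ν := orthant p) (fun x => k x * a x)
    (fun s => f (fstArg h' t s) * g (sndArg h' t s))
  have hmp : MeasurePreserving (MeasurableEquiv.piFinSuccAbove (fun _ : Fin (p + 1) => ℝ) 0)
    (orthant (p + 1)) (halfLine.prod (orthant p)) := measurePreserving_head p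
  rw [← hmp.integral_comp'] at key
  refine Eq.trans (integral_congr_ae (Eventually.of_forall fun s => ?_)) key
  obtain ⟨hl, hr, htot⟩ := id h
  have e1 : (fun i : Fin n => fstArg h t s i.castSucc) = fstArg h' t (fun i => s i.succ) := by
    funext i
    simp only [fstArg, Fin.val_castSucc, Nat.add_sub_add_right, Fin.succ_mk]
    split_ifs with hi
    · rfl
    · congr 2
      omega
  have e2 : fstArg h t s (Fin.last n) = s 0 := by simp [fstArg]
  have e3 : (fun i : Fin m => sndArg h t s i.succ) = sndArg h' t (fun i => s i.succ) := by
    funext i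
    simp [sndArg]
  have e4 : sndArg h t s 0 = s 0 := by simp [sndArg]
  simp only [e1, e2, e3, e4]
  show _ = k (s 0) * a (s 0) * (f (fstArg h' t fun i => s i.succ) * g (sndArg h' t fun i => s i.succ))
  ring

/-! ### Contraction operators on Fock space -/

/-- Injectivity of `D` where `T c ≠ 0` means that each component of `ξ` is used at most once, so the
squared norms add up to at most `C² ‖ξ‖²`. -/
theorem sum_norm_graded_le (D : ℕ → ℕ) (T : ∀ c, Kernel (D c) →L[ℂ] Kernel c) {C : ℝ} (hC : 0 ≤ C)
    (hT : ∀ c x, ‖T c x‖ ≤ C * ‖x‖) (hD : Set.InjOn D {c | T c ≠ 0}) (ξ : Fock) (s : Finset ℕ) :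
    ∑ c ∈ s, ‖T c (ξ (D c))‖ ^ (2 : ℝ≥0∞).toReal ≤ (C * ‖ξ‖) ^ (2 : ℝ≥0∞).toReal := by
  classical
  have h2 : (0 : ℝ) < (2 : ℝ≥0∞).toReal := by norm_num
  calc _ = ∑ c ∈ s.filter (fun c => T c ≠ 0), ‖T c (ξ (D c))‖ ^ (2 : ℝ≥0∞).toReal := by
        refine (Finset.sum_filter_of_ne (p := fun c => T c ≠ 0) fun c _ h h0 => h ?_).symm
        rw [h0]
        simp
    _ ≤ ∑ c ∈ s.filter (fun c => T c ≠ 0),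
          C ^ (2 : ℝ≥0∞).toReal * ‖ξ (D c)‖ ^ (2 : ℝ≥0∞).toReal := by
        refine Finset.sum_le_sum fun c _ => ?_
        rw [← Real.mul_rpow hC (norm_nonneg _)]
        exact Real.rpow_le_rpow (norm_nonneg _) (hT c _) h2.le
    _ = C ^ (2 : ℝ≥0∞).toReal *
          ∑ k ∈ (s.filter fun c => T c ≠ 0).image D, ‖ξ k‖ ^ (2 : ℝ≥0∞).toReal := by
        rw [Finset.sum_image, Finset.mul_sum]
        exact hD.mono fun c hc => (Finset.mem_filter.1 hc).2
    _ ≤ _ := by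
        rw [Real.mul_rpow hC (norm_nonneg _)]
        exact mul_le_mul_of_nonneg_left (lp.sum_rpow_le_norm_rpow h2 ξ _) (by positivity)

/-- The operator on Fock space with components `c ↦ T c (ξ (D c))`, for maps `T c` of norm at most
`C`, where `D` is injective on the `c` with `T c ≠ 0`. -/
def gradedMap (D : ℕ → ℕ) (T : ∀ c, Kernel (D c) →L[ℂ] Kernel c) {C : ℝ} (hC : 0 ≤ C)
    (hT : ∀ c x, ‖T c x‖ ≤ C * ‖x‖) (hD : Set.InjOn D {c | T c ≠ 0}) : Fock →L[ℂ] Fock :=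
  LinearMap.mkContinuous
    { toFun := fun ξ => ⟨fun c => T c (ξ (D c)), memℓp_gen' (sum_norm_graded_le D T hC hT hD ξ)⟩
      map_add' := fun ξ η => by
        ext1; funext c
        exact map_add (T c) (ξ (D c)) (η (D c))
      map_smul' := fun a ξ => by
        ext1; funext c
        exact map_smul (T c) a (ξ (D c)) }
    C
    (fun ξ => lp.norm_le_of_forall_sum_le (by norm_num) (by positivity)
      (sum_norm_graded_le D T hC hT hD ξ))

theorem norm_gradedMap_le (D : ℕ → ℕ) (T : ∀ c, Kernel (D c) →L[ℂ] Kernel c) {C : ℝ} (hC : 0 ≤ C)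
    (hT : ∀ c x, ‖T c x‖ ≤ C * ‖x‖) (hD : Set.InjOn D {c | T c ≠ 0}) :
    ‖gradedMap D T hC hT hD‖ ≤ C :=
  ContinuousLinearMap.opNorm_le_bound _ hC fun ξ =>
    lp.norm_le_of_forall_sum_le (by norm_num) (by positivity) (sum_norm_graded_le D T hC hT hD ξ)

open Classical in
/-- The contraction, extended by zero to all arities. -/
def contrOrZero (n m p c : ℕ) : Kernel n →L[ℂ] Kernel m →L[ℂ] Kernel c :=
  if h : Fits n m p c then contr h else 0

theorem contrOrZero_of_fits (h : Fits n m p c) : contrOrZero n m p c = contr h := dif_pos h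

theorem contrOrZero_of_not_fits (h : ¬ Fits n m p c) : contrOrZero n m p c = 0 := dif_neg h

theorem norm_contrOrZero_le (f : Kernel n) (g : Kernel m) :
    ‖contrOrZero n m p c f g‖ ≤ ‖f‖ * ‖g‖ := by
  by_cases h : Fits n m p c
  · rw [contrOrZero_of_fits h]
    exact norm_contr_le h f g
  · rw [contrOrZero_of_not_fits h]
    simpa using by positivity

/-- The operator `ξ ↦ f ⌢ᵖ ξ` on Fock space: it creates the first `n - p` arguments of `f` and
annihilates with the last `p`. -/
def contractWith (p : ℕ) (f : Kernel n) : Fock →L[ℂ] Fock :=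
  gradedMap (fun c => c + 2 * p - n) (fun c => contrOrZero n (c + 2 * p - n) p c f)
    (norm_nonneg f) (fun _ x => norm_contrOrZero_le f x) (by
      -- The truncated subtraction `c + 2 * p - n` is not injective in general. On arities that fit
      -- it is exact, and `c + 2 * p = n + m` recovers `c`.
      intro c hc c' hc' h
      by_contra hne
      have h1 : Fits n (c + 2 * p - n) p c := by
        by_contra h1
        exact hc (by rw [contrOrZero_of_not_fits h1]; rfl)
      have h2 : Fits n (c' + 2 * p - n) p c' := by
        by_contra h2
        exact hc' (by rw [contrOrZero_of_not_fits h2]; rfl)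
      have h3 := h1.total
      have h4 := h2.total
      simp only at h
      omega)

theorem contractWith_apply (p : ℕ) (f : Kernel n) (ξ : Fock) (c : ℕ) :
    contractWith p f ξ c = contrOrZero n (c + 2 * p - n) p c f (ξ (c + 2 * p - n)) := rfl

theorem norm_contractWith_le (p : ℕ) (f : Kernel n) : ‖contractWith p f‖ ≤ ‖f‖ :=
  norm_gradedMap_le _ _ _ _ _

theorem contractWith_single (h : Fits n m p c) (f : Kernel n) (g : Kernel m) :
    contractWith p f (lp.single 2 m g) = lp.single 2 c (contr h f g) := by
  ext1
  funext k
  rw [contractWith_apply]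
  have htot := h.total
  by_cases hk : k = c
  · subst hk
    rw [lp.single_apply_self]
    have e : k + 2 * p - n = m := by omega
    rw [← contrOrZero_of_fits h]
    generalize k + 2 * p - n = m' at e
    subst e
    rw [lp.single_apply_self]
  · rw [lp.single_apply_ne _ _ _ hk]
    by_cases hF : Fits n (k + 2 * p - n) p k
    · have := hF.total
      rw [lp.single_apply_ne _ _ _ (by omega), map_zero]
    · rw [contrOrZero_of_not_fits hF]
      rfl

theorem contractWith_single_of_not_le (h : ¬ (p ≤ n ∧ p ≤ m)) (f : Kernel n) (g : Kernel m) :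
    contractWith p f (lp.single 2 m g) = 0 := by
  ext1
  funext k
  rw [contractWith_apply]
  by_cases hF : Fits n (k + 2 * p - n) p k
  · obtain ⟨h1, h2, h3⟩ := hF
    rw [lp.single_apply_ne _ _ _ (by rintro rfl; exact h ⟨h1, h2⟩), map_zero]
    rfl
  · rw [contrOrZero_of_not_fits hF]
    rfl

/-- `contractWith` as a bounded linear map of the kernel. -/
def contractWithL (n p : ℕ) : Kernel n →L[ℂ] Fock →L[ℂ] Fock :=
  LinearMap.mkContinuous
    { toFun := contractWith p
      map_add' := fun f f' => by
        ext1 ξ; ext1; funext c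
        simp only [contractWith_apply, map_add, add_apply]
        rfl
      map_smul' := fun a f => by
        ext1 ξ; ext1; funext c
        simp only [contractWith_apply, map_smul, smul_apply]
        rfl }
    1 (fun f => by simpa using norm_contractWith_le p f)

/-- The multiple Wigner integral as a bounded linear map of the kernel. -/
def integralL (n : ℕ) : Kernel n →L[ℂ] Fock →L[ℂ] Fock :=
  ∑ p ∈ Finset.range (n + 1), contractWithL n p

theorem integralL_apply (f : Kernel n) :
    integralL n f = ∑ p ∈ Finset.range (n + 1), contractWith p f := by
  rw [integralL, sum_apply]
  rfl

/-! ### Creation, annihilation and the vacuum -/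

theorem creation_single (h : OneParticle) (f : Kernel n) :
    creation h (lp.single 2 n f) = lp.single 2 (n + 1) (prepend h f) := by
  ext1
  funext k
  show creationComponent h (lp.single 2 n f) k = _
  have h0 : ∀ k, prepend h (0 : Kernel k) = 0 := fun k => by
    simpa using prepend_smul h 0 (0 : Kernel k)
  cases k with
  | zero => rw [lp.single_apply_ne _ _ _ (by omega)]; rfl
  | succ k =>
    show prepend h _ = _
    by_cases hk : k = n
    · subst hk
      rw [lp.single_apply_self, lp.single_apply_self]
    · rw [lp.single_apply_ne _ _ _ hk, lp.single_apply_ne _ _ _ (by omega)]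
      exact h0 k

theorem inner_prepend (h a : OneParticle) (f g : Kernel n) :
    inner ℂ (prepend h f) (prepend a g) = inner ℂ h a * inner ℂ f g := by
  rw [L2.inner_def, L2.inner_def, L2.inner_def, ← integral_prod_mul]
  have hmp : MeasurePreserving (MeasurableEquiv.piFinSuccAbove (fun _ : Fin (n + 1) => ℝ) 0)
    (orthant (n + 1)) (halfLine.prod (orthant n)) := measurePreserving_head n
  rw [← hmp.integral_comp']
  refine integral_congr_ae ?_
  filter_upwards [coeFn_prepend h f, coeFn_prepend a g] with t h1 h2
  rw [h1, h2]
  show inner ℂ (h (t 0) * f fun i => t i.succ) (a (t 0) * g fun i => t i.succ) =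
    inner ℂ (h (t 0)) (a (t 0)) * inner ℂ (f fun i => t i.succ) (g fun i => t i.succ)
  simp only [RCLike.inner_apply, map_mul]
  ring

theorem inner_creation (h a : OneParticle) (ξ η : Fock) :
    inner ℂ (creation h ξ) (creation a η) = inner ℂ h a * inner ℂ ξ η := by
  have h1 := (lp.hasSum_inner (𝕜 := ℂ) ξ η).mul_left (inner ℂ h a)
  have h2 := lp.hasSum_inner (𝕜 := ℂ) (creation h ξ) (creation a η)
  -- Created vectors have no component of degree `0`, so the sum may be shifted by one.
  rw [← hasSum_nat_add_iff' 1] at h2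
  have h3 : inner ℂ (creation h ξ 0) (creation a η 0) = (0 : ℂ) :=
    inner_zero_left (𝕜 := ℂ) (creation a η 0)
  simp only [Finset.sum_range_one, h3, sub_zero] at h2
  exact h2.unique ((funext fun k => inner_prepend h a (ξ k) (η k) :
    (fun k => inner ℂ (creation h ξ (k + 1)) (creation a η (k + 1))) = _) ▸ h1)

/-- The adjoint form of `inner_creation`. Together with `annihilation_vacuum` it determines
`annihilation h`, since the vacuum and the ranges of the creation operators span a dense subspace.
-/
theorem annihilation_mul_creation (h a : OneParticle) :
    annihilation h * creation a = (inner ℂ h a : ℂ) • (1 : Fock →L[ℂ] Fock) := by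
  ext1 η
  refine ext_inner_left ℂ fun ξ => ?_
  show inner ℂ ξ (ContinuousLinearMap.adjoint (creation h) (creation a η)) = inner ℂ ξ ((inner ℂ h a : ℂ) • η)
  rw [ContinuousLinearMap.adjoint_inner_right, inner_creation, inner_smul_right]

theorem annihilation_vacuum (h : OneParticle) : annihilation h vacuum = 0 := by
  refine ext_inner_left ℂ fun ξ => ?_
  show inner ℂ ξ (ContinuousLinearMap.adjoint (creation h) vacuum) = inner ℂ ξ 0
  rw [ContinuousLinearMap.adjoint_inner_right, inner_zero_right, vacuum, lp.inner_single_right]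
  exact inner_zero_left _

/-- The constant `1`, the generator of `L²(ℝ₊⁰)`. -/
def unitKernel : Kernel 0 :=
  indicatorConstLp 2 (μ := orthant 0) MeasurableSet.univ (by simp [orthant]) (1 : ℂ)

theorem vacuum_eq : vacuum = lp.single 2 0 unitKernel := rfl

theorem coeFn_unitKernel : unitKernel =ᵐ[orthant 0] fun _ => 1 := by
  refine indicatorConstLp_coeFn.trans ?_
  simp

theorem contr_unitKernel (h : Fits n 0 0 n) (f : Kernel n) : contr h f unitKernel = f := by
  refine Eq.trans ?_ (Lp.toLp_coeFn f (Lp.memLp f))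
  refine (MemLp.toLp_eq_toLp_iff (memLp_contrFun h _ _) _).2 ?_
  refine (contrFun_congr h (ae_eq_refl f) coeFn_unitKernel).trans (Eventually.of_forall fun t => ?_)
  have : ∀ s, fstArg h t s = t := fun s => by
    funext i
    simp [fstArg]
  have huniv : (orthant 0).real Set.univ = 1 := by simp [orthant, Measure.real]
  simp [contrFun, this, huniv]

/-- The vacuum has no argument to contract with, so only the term `p = 0` survives. This is the
isometry `‖Iₙ(f)‖₂ = ‖f‖` in vector form. -/
theorem integralL_vacuum (f : Kernel n) : integralL n f vacuum = lp.single 2 n f := by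
  have hfit : Fits n 0 0 n := ⟨by omega, le_rfl, by omega⟩
  rw [integralL_apply, sum_apply, Finset.sum_eq_single 0, vacuum_eq,
    contractWith_single hfit, contr_unitKernel]
  · intro p _ hp
    exact contractWith_single_of_not_le (by omega) _ _
  · simp

/-! ### Integrals of rectangles -/

theorem coeFn_rectangle_kernel (A : Rectangle n) :
    A.kernel =ᵐ[orthant n] (Set.Icc A.lower A.upper).indicator fun _ => 1 :=
  indicatorConstLp_coeFn

/-- The indicator of `[u, v]` in `L²(ℝ₊)`. -/
def intervalKernel (u v : ℝ) : OneParticle :=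
  indicatorConstLp 2 (μ := halfLine) (measurableSet_Icc (a := u) (b := v))
    (halfLine_Icc_ne_top u v) (1 : ℂ)

theorem coeFn_intervalKernel (u v : ℝ) :
    intervalKernel u v =ᵐ[halfLine] (Set.Icc u v).indicator fun _ => 1 :=
  indicatorConstLp_coeFn

/-- The rectangle without its first side. -/
def Rectangle.tail (A : Rectangle (n + 1)) : Rectangle n where
  lower i := A.lower i.succ
  upper i := A.upper i.succ
  lower_nonneg i := A.lower_nonneg _
  lower_le_upper i := A.lower_le_upper _
  off_diagonal := by
    refine Set.disjoint_left.2 fun t ht ⟨i, j, hij, h⟩ => ?_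
    have hd : ∀ x ∈ Set.Icc A.lower A.upper, x ∉ diagonals (n + 1) :=
      fun _ hx => Set.disjoint_left.1 A.off_diagonal hx
    -- A repeated coordinate stays repeated when another is inserted; the lower endpoint is an
    -- admissible value because sides are nonempty.
    refine hd (Fin.cons (A.lower 0) t) ⟨?_, ?_⟩
      ⟨i.succ, j.succ, by simpa using hij, by simpa using h⟩
    · exact Fin.cases le_rfl fun k => by simpa using ht.1 k
    · exact Fin.cases (A.lower_le_upper 0) fun k => by simpa using ht.2 k

/-- The rectangle without its last side. -/
def Rectangle.init (A : Rectangle (n + 1)) : Rectangle n where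
  lower i := A.lower i.castSucc
  upper i := A.upper i.castSucc
  lower_nonneg i := A.lower_nonneg _
  lower_le_upper i := A.lower_le_upper _
  off_diagonal := by
    refine Set.disjoint_left.2 fun t ht ⟨i, j, hij, h⟩ => ?_
    have hd : ∀ x ∈ Set.Icc A.lower A.upper, x ∉ diagonals (n + 1) :=
      fun _ hx => Set.disjoint_left.1 A.off_diagonal hx
    refine hd (Fin.snoc (α := fun _ => ℝ) t (A.lower (Fin.last n))) ⟨?_, ?_⟩
      ⟨i.castSucc, j.castSucc, by simpa using hij, by simpa using h⟩
    · exact Fin.lastCases (by simp) fun k => by simpa using ht.1 k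
    · exact Fin.lastCases (by simpa using A.lower_le_upper _) fun k => by simpa using ht.2 k

theorem measurePreserving_coord (i : Fin (n + 1)) :
    Measure.QuasiMeasurePreserving (fun t : Fin (n + 1) → ℝ => t i) (orthant (n + 1)) halfLine :=
  Measure.quasiMeasurePreserving_fst.comp
    (measurePreserving_piFinSuccAbove (fun _ : Fin (n + 1) => halfLine) i).quasiMeasurePreserving

theorem quasiMeasurePreserving_init :
    Measure.QuasiMeasurePreserving (fun (t : Fin (n + 1) → ℝ) (i : Fin n) => t i.castSucc)
      (orthant (n + 1)) (orthant n) := by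
  have := Measure.quasiMeasurePreserving_snd.comp (measurePreserving_piFinSuccAbove
    (fun _ : Fin (n + 1) => halfLine) (Fin.last n)).quasiMeasurePreserving
  convert! this using 1
  funext t i
  simp [Fin.init]

theorem indicator_one_mul_indicator_one {α β : Type*} (s : Set α) (t : Set β) (a : α) (b : β) :
    s.indicator (fun _ => (1 : ℂ)) a * t.indicator (fun _ => 1) b =
      (s ×ˢ t).indicator (fun _ => 1) (a, b) := by
  classical
  simp only [Set.indicator_apply, Set.mem_prod]
  split_ifs <;> simp_all

theorem rectangle_kernel_eq_prepend (A : Rectangle (n + 1)) :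
    A.kernel = prepend (intervalKernel (A.lower 0) (A.upper 0)) A.tail.kernel := by
  refine Lp.ext ?_
  filter_upwards [coeFn_rectangle_kernel A, coeFn_prepend (intervalKernel (A.lower 0) (A.upper 0))
    A.tail.kernel, tail_ae (coeFn_rectangle_kernel A.tail),
    (measurePreserving_coord 0).ae (coeFn_intervalKernel (A.lower 0) (A.upper 0))] with t h1 h2 h3 h4
  rw [h1, h2, h3, h4, indicator_one_mul_indicator_one]
  classical
  simp only [Set.indicator_apply, Set.mem_prod, Set.mem_Icc, Pi.le_def, Fin.forall_fin_succ,
    Rectangle.tail]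
  congr 1
  simp only [eq_iff_iff]
  tauto

theorem coeFn_rectangle_kernel_init (A : Rectangle (n + 1)) :
    A.kernel =ᵐ[orthant (n + 1)] fun t => A.init.kernel (fun i => t i.castSucc) *
      intervalKernel (A.lower (Fin.last n)) (A.upper (Fin.last n)) (t (Fin.last n)) := by
  filter_upwards [coeFn_rectangle_kernel A,
    quasiMeasurePreserving_init.ae (coeFn_rectangle_kernel A.init),
    (measurePreserving_coord (Fin.last n)).ae
      (coeFn_intervalKernel (A.lower (Fin.last n)) (A.upper (Fin.last n)))] with t h1 h3 h4
  rw [h1, h3, h4, indicator_one_mul_indicator_one]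
  classical
  simp only [Set.indicator_apply, Set.mem_prod, Set.mem_Icc, Pi.le_def, Fin.forall_fin_succ',
    Rectangle.init]
  congr 1
  simp only [eq_iff_iff]
  tauto

theorem rectangle_kernel_zero (A : Rectangle 0) : A.kernel = unitKernel := by
  refine Lp.ext ?_
  filter_upwards [coeFn_rectangle_kernel A, coeFn_unitKernel] with t h1 h2
  rw [h1, h2, Set.indicator_of_mem]
  exact ⟨fun i => i.elim0, fun i => i.elim0⟩

/-- Operators on Fock space that agree on the vacuum and after creation are equal. -/
theorem fock_ext_creation {S T : Fock →L[ℂ] Fock} (h0 : S vacuum = T vacuum)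
    (h : ∀ a ξ, S (creation a ξ) = T (creation a ξ)) : S = T := by
  refine fock_ext fun n A => ?_
  cases n with
  | zero => rwa [rectangle_kernel_zero]
  | succ n => rw [rectangle_kernel_eq_prepend, ← creation_single, h]

/-- Associativity of the tensor product: `(f ⊗ k) ⊗ ξ = f ⊗ (k ⊗ ξ)`. -/
theorem contractWith_zero_append {f : Kernel n} {k : OneParticle} {F : Kernel (n + 1)}
    (hF : F =ᵐ[orthant (n + 1)] fun t => f (fun i => t i.castSucc) * k (t (Fin.last n))) :
    contractWith 0 F = contractWith 0 f * creation k := by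
  refine fock_ext fun m A => ?_
  have h : Fits (n + 1) m 0 (n + 1 + m) := ⟨by omega, by omega, by omega⟩
  have h' : Fits n (m + 1) 0 (n + 1 + m) := ⟨by omega, by omega, by omega⟩
  rw [mul_apply_eq_comp, creation_single, contractWith_single h,
    contractWith_single h', contr_zero_append hF h h']

/-- Contractions pair bilinearly, inner products sesquilinearly; for real `k` the two agree. -/
theorem inner_of_real {k : OneParticle} (hk : ∀ᵐ x ∂halfLine, (k x).im = 0) (a : OneParticle) :
    inner ℂ k a = ∫ x, k x * a x ∂halfLine := by
  rw [L2.inner_def]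
  refine integral_congr_ae ?_
  filter_upwards [hk] with x hx
  rw [RCLike.inner_apply, Complex.conj_eq_iff_im.2 hx, mul_comm]

/-- The innermost pairing is between the last argument of `F` and the first argument of the vector,
which is the action of `l*(k)`. It suffices to test on the vacuum and on created vectors, where
`l*(k) l(a) = ⟨k, a⟩`. -/
theorem contractWith_succ_append {f : Kernel n} {k : OneParticle} {F : Kernel (n + 1)}
    (hk : ∀ᵐ x ∂halfLine, (k x).im = 0)
    (hF : F =ᵐ[orthant (n + 1)] fun t => f (fun i => t i.castSucc) * k (t (Fin.last n))) (p : ℕ) :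
    contractWith (p + 1) F = contractWith p f * annihilation k := by
  refine fock_ext_creation ?_ fun a ξ => ?_
  · rw [mul_apply_eq_comp, annihilation_vacuum, map_zero, vacuum_eq,
      contractWith_single_of_not_le (by omega)]
  · suffices contractWith (p + 1) F * creation a =
        (inner ℂ k a : ℂ) • contractWith p f by
      have h1 := congrArg (fun T : Fock →L[ℂ] Fock => T ξ) this
      have h2 := congrArg (fun T : Fock →L[ℂ] Fock => T ξ) (annihilation_mul_creation k a)
      simp only [mul_apply_eq_comp, smul_apply,
        one_apply_eq_self] at h1 h2
      rw [h1, mul_apply_eq_comp, h2, map_smul]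
    refine fock_ext fun m A => ?_
    rw [mul_apply_eq_comp, creation_single, smul_apply]
    by_cases hp : p ≤ n ∧ p ≤ m
    · have h : Fits (n + 1) (m + 1) (p + 1) (n + m - 2 * p) := ⟨by omega, by omega, by omega⟩
      have h' : Fits n m p (n + m - 2 * p) := ⟨by omega, by omega, by omega⟩
      rw [contractWith_single h, contractWith_single h', contr_succ_append_prepend hF h h',
        inner_of_real hk, lp.single_smul]
    · rw [contractWith_single_of_not_le hp, contractWith_single_of_not_le (by omega), smul_zero]

theorem prepend_add_left (h k : OneParticle) (f : Kernel n) :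
    prepend (h + k) f = prepend h f + prepend k f := by
  refine Eq.trans ?_ (MemLp.toLp_add (memLp_prepend h f) (memLp_prepend k f))
  refine (MemLp.toLp_eq_toLp_iff _ _).2 ?_
  filter_upwards [(measurePreserving_coord 0).ae (Lp.coeFn_add h k)] with t ht
  simp only [Pi.add_apply] at ht ⊢
  rw [ht, add_mul]

theorem creation_add (h k : OneParticle) : creation (h + k) = creation h + creation k := by
  refine fock_ext fun m A => ?_
  rw [add_apply, creation_single, creation_single, creation_single, prepend_add_left,
    lp.single_add]

theorem semicircular_add (h k : OneParticle) :
    semicircular (h + k) = semicircular h + semicircular k := by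
  rw [semicircular, annihilation, creation_add, map_add, semicircular, semicircular, annihilation,
    annihilation]
  abel

theorem halfLine_singleton (x : ℝ) : halfLine {x} = 0 :=
  le_antisymm ((Measure.restrict_apply_le _ _).trans (by simp)) zero_le

/-- The closed intervals overlap in the single point `u`, which is null. -/
theorem intervalKernel_add {u v : ℝ} (hu : 0 ≤ u) (huv : u ≤ v) :
    intervalKernel 0 v = intervalKernel 0 u + intervalKernel u v := by
  refine Lp.ext ?_
  filter_upwards [coeFn_intervalKernel 0 v, coeFn_intervalKernel 0 u, coeFn_intervalKernel u v,
    Lp.coeFn_add (intervalKernel 0 u) (intervalKernel u v),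
    measure_eq_zero_iff_ae_notMem.1 (halfLine_singleton u)] with x h1 h2 h3 h4 h5
  rw [h4, Pi.add_apply, h1, h2, h3]
  have hxu : x ≠ u := h5
  classical
  simp only [Set.indicator_apply, Set.mem_Icc]
  rcases lt_or_gt_of_ne hxu with h | h
  · simp [h.le, h.not_ge, h.le.trans huv]
  · simp [h.le, h.not_ge, hu.trans h.le]

theorem brownian_sub_brownian {u v : ℝ} (hu : 0 ≤ u) (huv : u ≤ v) :
    brownian v - brownian u = semicircular (intervalKernel u v) := by
  rw [sub_eq_iff_eq_add']
  exact (congrArg semicircular (intervalKernel_add hu huv)).trans (semicircular_add _ _)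

theorem intervalKernel_real (u v : ℝ) : ∀ᵐ x ∂halfLine, (intervalKernel u v x).im = 0 := by
  filter_upwards [coeFn_intervalKernel u v] with x hx
  rw [hx]
  classical
  rw [Set.indicator_apply]
  split_ifs <;> simp

theorem inner_intervalKernel_of_disjoint {u v u' v' : ℝ}
    (h : Disjoint (Set.Icc u v) (Set.Icc u' v')) :
    inner ℂ (intervalKernel u v) (intervalKernel u' v') = (0 : ℂ) := by
  rw [L2.inner_def]
  refine integral_eq_zero_of_ae ?_
  filter_upwards [coeFn_intervalKernel u v, coeFn_intervalKernel u' v'] with x h1 h2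
  rw [h1, h2]
  by_cases hx : x ∈ Set.Icc u v
  · rw [Set.indicator_of_notMem (Set.disjoint_left.1 h hx)]
    simp
  · rw [Set.indicator_of_notMem hx]
    simp

theorem Rectangle.disjoint_sides (A : Rectangle n) {i j : Fin n} (hij : i ≠ j) :
    Disjoint (Set.Icc (A.lower i) (A.upper i)) (Set.Icc (A.lower j) (A.upper j)) := by
  refine Set.disjoint_left.2 fun x hi hj => ?_
  have hd : ∀ t ∈ Set.Icc A.lower A.upper, t ∉ diagonals n :=
    fun _ ht => Set.disjoint_left.1 A.off_diagonal ht
  -- A common point `x` of two sides, placed in both coordinates and completed by lower endpoints,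
  -- would be a diagonal point of the rectangle.
  refine hd (fun k => if k = i ∨ k = j then x else A.lower k) ⟨fun k => ?_, fun k => ?_⟩
    ⟨i, j, hij, by simp⟩
  · by_cases h : k = i ∨ k = j
    · simp only [h, if_true]
      rcases h with rfl | rfl
      exacts [hi.1, hj.1]
    · simp [h]
  · by_cases h : k = i ∨ k = j
    · simp only [h, if_true]
      rcases h with rfl | rfl
      exacts [hi.2, hj.2]
    · simpa [h] using A.lower_le_upper k

theorem Rectangle.integral_succ (A : Rectangle (n + 1)) :
    A.integral = A.init.integral *
      semicircular (intervalKernel (A.lower (Fin.last n)) (A.upper (Fin.last n))) := by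
  rw [Rectangle.integral, List.ofFn_succ', List.prod_concat,
    brownian_sub_brownian (A.lower_nonneg _) (A.lower_le_upper _)]
  rfl

/-- After a creation by an interval disjoint from the last side, only tensoring survives. -/
theorem contractWith_mul_creation_eq_zero (A : Rectangle (n + 1)) (hp : p + 1 ≤ n) :
    contractWith (p + 1) A.init.kernel *
      creation (intervalKernel (A.lower (Fin.last n)) (A.upper (Fin.last n))) = 0 := by
  obtain ⟨n, rfl⟩ : ∃ k, n = k + 1 := ⟨n - 1, by omega⟩
  -- The last annihilator of the contraction belongs to the penultimate side. It stands directly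
  -- left of the creator of the last side, and the two sides are orthogonal.
  rw [contractWith_succ_append (intervalKernel_real _ _) (coeFn_rectangle_kernel_init A.init),
    mul_assoc, annihilation_mul_creation]
  have := inner_intervalKernel_of_disjoint
    (A.disjoint_sides (i := (Fin.last n).castSucc) (j := Fin.last (n + 1)) (by simp [Fin.ext_iff]))
  simp only [Rectangle.init] at this ⊢
  rw [this, zero_smul, mul_zero]

theorem contractWith_zero_unitKernel : contractWith 0 unitKernel = 1 := by
  refine fock_ext fun m A => ?_
  have h : Fits 0 m 0 m := ⟨le_rfl, by omega, by omega⟩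
  rw [contractWith_single h, one_apply_eq_self]
  congr 1
  refine Eq.trans ?_ (Lp.toLp_coeFn A.kernel (Lp.memLp _))
  refine (MemLp.toLp_eq_toLp_iff (memLp_contrFun h _ _) _).2 ?_
  refine (contrFun_congr h coeFn_unitKernel (ae_eq_refl _)).trans
    (Eventually.of_forall fun t => ?_)
  have : ∀ s, sndArg h t s = t := fun s => by
    funext i
    simp [sndArg]
  have huniv : (orthant 0).real Set.univ = 1 := by simp [orthant, Measure.real]
  simp [contrFun, this, huniv]

/-- The integral of the indicator of a rectangle is the product of increments. -/
theorem integralL_rectangle (A : Rectangle n) : integralL n A.kernel = A.integral := by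
  induction n with
  | zero =>
    rw [integralL_apply, rectangle_kernel_zero]
    simp [Rectangle.integral, contractWith_zero_unitKernel]
  | succ n ih =>
    have h1 : ∀ p ∈ Finset.range n, contractWith (p + 1) A.init.kernel *
        creation (intervalKernel (A.lower (Fin.last n)) (A.upper (Fin.last n))) = 0 :=
      fun p hp => contractWith_mul_creation_eq_zero A (by have := Finset.mem_range.1 hp; omega)
    -- With `S = l + l*` on the last side, multiplying by `l*` raises each contraction order by one.
    -- Multiplying by `l` kills all orders except `0`, which supplies the missing term of order `0`.
    rw [A.integral_succ, ← ih, semicircular, mul_add, integralL_apply, integralL_apply,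
      Finset.sum_range_succ', contractWith_zero_append (coeFn_rectangle_kernel_init A),
      Finset.sum_congr rfl fun p _ => contractWith_succ_append (intervalKernel_real _ _)
        (coeFn_rectangle_kernel_init A) p, Finset.sum_mul, Finset.sum_mul,
      Finset.sum_range_succ' (fun p => contractWith p A.init.kernel * creation _),
      Finset.sum_eq_zero h1, zero_add, add_comm]

theorem integralL_simple (φ : Simple n) : integralL n φ.kernel = φ.integral := by
  rw [Simple.kernel, Simple.integral, Finsupp.sum, Finsupp.sum, map_sum]
  refine Finset.sum_congr rfl fun A _ => ?_
  rw [map_smul, integralL_rectangle]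

/-! ### Reversal of arguments and right semicircular operators -/

theorem measurePreserving_rev (n : ℕ) :
    MeasurePreserving (fun (t : Fin n → ℝ) (i : Fin n) => t i.rev) (orthant n) (orthant n) := by
  have := measurePreserving_piCongrLeft (α := fun _ : Fin n => ℝ) (fun _ => halfLine) Fin.revPerm
  convert! this using 1
  funext t i
  obtain ⟨j, rfl⟩ := Fin.revPerm.surjective i
  rw [MeasurableEquiv.coe_piCongrLeft, Equiv.piCongrLeft_apply_apply]
  simp

/-- Reversal of the arguments of a kernel. -/
def flipKernel (n : ℕ) : Kernel n →ₗᵢ[ℂ] Kernel n :=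
  Lp.compMeasurePreservingₗᵢ ℂ _ (measurePreserving_rev n)

theorem coeFn_flipKernel (f : Kernel n) :
    flipKernel n f =ᵐ[orthant n] fun t => f fun i => t i.rev :=
  Lp.coeFn_compMeasurePreserving f (measurePreserving_rev n)

theorem flipKernel_flipKernel (f : Kernel n) : flipKernel n (flipKernel n f) = f := by
  refine Lp.ext ?_
  filter_upwards [coeFn_flipKernel (flipKernel n f),
    (measurePreserving_rev n).quasiMeasurePreserving.ae (coeFn_flipKernel f)] with t h1 h2
  rw [h1, h2]
  simp

/-- Reversal of the arguments, on Fock space. -/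
def flip : Fock →L[ℂ] Fock :=
  gradedMap (fun c => c) (fun c => (flipKernel c).toContinuousLinearMap) zero_le_one
    (fun c x => by simp) (fun _ _ _ _ h => h)

theorem flip_apply (ξ : Fock) (c : ℕ) : flip ξ c = flipKernel c (ξ c) := rfl

theorem flip_single (f : Kernel n) :
    flip (lp.single 2 n f) = lp.single 2 n (flipKernel n f) := by
  ext1
  funext k
  rw [flip_apply]
  by_cases hk : k = n
  · subst hk
    rw [lp.single_apply_self, lp.single_apply_self]
  · rw [lp.single_apply_ne _ _ _ hk, lp.single_apply_ne _ _ _ hk, map_zero]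

theorem flip_flip (ξ : Fock) : flip (flip ξ) = ξ := by
  ext1
  funext k
  exact flipKernel_flipKernel _

theorem flip_mul_flip : flip * flip = 1 := by
  ext1 ξ
  exact flip_flip ξ

theorem norm_flip (ξ : Fock) : ‖flip ξ‖ = ‖ξ‖ := by
  have h : ∀ ξ, ‖flip ξ‖ ≤ ‖ξ‖ := fun ξ => by
    simpa using (flip.le_opNorm ξ).trans
      (mul_le_mul_of_nonneg_right (norm_gradedMap_le _ _ zero_le_one _ _) (norm_nonneg ξ))
  exact le_antisymm (h ξ) (by simpa [flip_flip] using h (flip ξ))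

/-- An isometric involution is self-adjoint. -/
theorem star_flip : star flip = flip := by
  have h : star flip * flip = 1 :=
    (ContinuousLinearMap.norm_map_iff_adjoint_comp_self flip).1 norm_flip
  calc star flip = star flip * (flip * flip) := by rw [flip_mul_flip, mul_one]
    _ = flip := by rw [← mul_assoc, h, one_mul]

theorem flip_vacuum : flip vacuum = vacuum := by
  rw [vacuum_eq, flip_single]
  congr 1

/-- The right creation operator `ξ ↦ ξ ⊗ k`. -/
def rightCreation (k : OneParticle) : Fock →L[ℂ] Fock := flip * creation k * flip

theorem rightCreation_single (k : OneParticle) (f : Kernel n) :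
    rightCreation k (lp.single 2 n f) =
      lp.single 2 (n + 1) (flipKernel (n + 1) (prepend k (flipKernel n f))) := by
  rw [rightCreation, mul_apply_eq_comp, mul_apply_eq_comp, flip_single,
    creation_single, flip_single]

theorem coeFn_append (k : OneParticle) (f : Kernel n) :
    flipKernel (n + 1) (prepend k (flipKernel n f)) =ᵐ[orthant (n + 1)]
      fun t => k (t (Fin.last n)) * f fun i => t i.castSucc := by
  filter_upwards [coeFn_flipKernel (prepend k (flipKernel n f)),
    (measurePreserving_rev (n + 1)).quasiMeasurePreserving.ae
      (coeFn_prepend k (flipKernel n f)),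
    (measurePreserving_rev (n + 1)).quasiMeasurePreserving.ae (tail_ae (coeFn_flipKernel f))]
    with t h1 h2 h3
  rw [h1, h2, h3]
  simp [Fin.rev_succ]

/-- Both orders send `f` to `h ⊗ f ⊗ k`. -/
theorem commute_creation_rightCreation (h k : OneParticle) :
    Commute (creation h) (rightCreation k) := by
  refine fock_ext fun n A => ?_
  generalize A.kernel = f
  rw [mul_apply_eq_comp, mul_apply_eq_comp, rightCreation_single,
    creation_single, creation_single, rightCreation_single]
  congr 1
  refine Lp.ext ?_
  filter_upwards [coeFn_prepend h (flipKernel (n + 1) (prepend k (flipKernel n f))),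
    tail_ae (coeFn_append k f), coeFn_append k (prepend h f),
    quasiMeasurePreserving_init.ae (coeFn_prepend h f)] with t h1 h2 h3 h4
  rw [h1, h2, h3, h4]
  simp only [Fin.succ_last, Fin.castSucc_zero, Fin.succ_castSucc]
  ring

/-- The projection onto the vacuum. -/
def vacuumProj : Fock →L[ℂ] Fock := InnerProductSpace.rankOne ℂ vacuum vacuum

theorem vacuumProj_apply (ξ : Fock) : vacuumProj ξ = (inner ℂ vacuum ξ : ℂ) • vacuum := rfl

theorem star_vacuumProj : star vacuumProj = vacuumProj := by
  rw [vacuumProj, ContinuousLinearMap.star_eq_adjoint, InnerProductSpace.adjoint_rankOne]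

theorem inner_vacuum_creation (h : OneParticle) (ξ : Fock) :
    inner ℂ vacuum (creation h ξ) = (0 : ℂ) := by
  rw [vacuum, lp.inner_single_left]
  exact inner_zero_right _

theorem inner_vacuum_vacuum : inner ℂ vacuum vacuum = (1 : ℂ) := by
  rw [vacuum_eq, lp.inner_single_left, lp.single_apply_self, L2.inner_def]
  refine (integral_congr_ae (g := fun _ => (1 : ℂ)) ?_).trans ?_
  · filter_upwards [coeFn_unitKernel] with t ht
    simp [ht]
  · simp [orthant, Measure.real]

theorem rightCreation_vacuum (k : OneParticle) : rightCreation k vacuum = creation k vacuum := by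
  rw [vacuum_eq, rightCreation_single, creation_single]
  congr 1
  refine Lp.ext ?_
  filter_upwards [coeFn_append k unitKernel, coeFn_prepend k unitKernel,
    quasiMeasurePreserving_init.ae coeFn_unitKernel, tail_ae coeFn_unitKernel] with t h1 h2 h3 h4
  rw [h1, h2, h3, h4]
  rfl

/-- One operator removes the first factor, the other appends a last one. They interfere only on the
vacuum, where the appended factor is also the first; this produces the rank-one term. -/
theorem annihilation_mul_rightCreation (h k : OneParticle) :
    annihilation h * rightCreation k =
      rightCreation k * annihilation h + (inner ℂ h k : ℂ) • vacuumProj := by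
  have hac : ∀ a b ξ, annihilation a (creation b ξ) = (inner ℂ a b : ℂ) • ξ := fun a b ξ =>
    congrArg (fun T : Fock →L[ℂ] Fock => T ξ) (annihilation_mul_creation a b)
  refine fock_ext_creation ?_ fun a ξ => ?_
  · simp only [mul_apply_eq_comp, add_apply, smul_apply]
    rw [rightCreation_vacuum, hac, annihilation_vacuum, map_zero, zero_add, vacuumProj_apply,
      inner_vacuum_vacuum, one_smul]
  · have hc : rightCreation k (creation a ξ) = creation a (rightCreation k ξ) :=
      (congrArg (fun T : Fock →L[ℂ] Fock => T ξ) (commute_creation_rightCreation a k)).symm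
    simp only [mul_apply_eq_comp, add_apply, smul_apply]
    rw [hc, hac, hac, map_smul, vacuumProj_apply, inner_vacuum_creation, zero_smul, smul_zero,
      add_zero]

theorem star_creation (h : OneParticle) : star (creation h) = annihilation h := rfl

theorem star_annihilation (h : OneParticle) : star (annihilation h) = creation h :=
  ContinuousLinearMap.adjoint_adjoint (creation h)

theorem inner_im_eq_zero_of_real {h k : OneParticle} (hh : ∀ᵐ x ∂halfLine, (h x).im = 0)
    (hk : ∀ᵐ x ∂halfLine, (k x).im = 0) : star (inner ℂ h k : ℂ) = inner ℂ h k := by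
  rw [inner_of_real hh]
  refine (integral_conj (𝕜 := ℂ)).symm.trans (integral_congr_ae ?_)
  filter_upwards [hh, hk] with x h1 h2
  rw [map_mul, Complex.conj_eq_iff_im.2 h1, Complex.conj_eq_iff_im.2 h2]

/-- Left and right semicircular operators of real functions commute. -/
theorem commute_semicircular_flip {h k : OneParticle} (hh : ∀ᵐ x ∂halfLine, (h x).im = 0)
    (hk : ∀ᵐ x ∂halfLine, (k x).im = 0) :
    Commute (semicircular h) (flip * semicircular k * flip) := by
  have e : flip * semicircular k * flip = rightCreation k + star (rightCreation k) := by
    rw [rightCreation, star_mul, star_mul, star_flip, star_creation, semicircular]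
    noncomm_ring
  have h1 : creation h * rightCreation k = rightCreation k * creation h :=
    commute_creation_rightCreation h k
  have h2 := annihilation_mul_rightCreation h k
  have h3 := congrArg star h1
  have h4 := congrArg star h2
  rw [star_mul, star_mul, star_creation] at h3
  rw [star_mul, star_add, star_mul, star_annihilation, star_smul, star_vacuumProj,
    inner_im_eq_zero_of_real hh hk] at h4
  rw [e, semicircular]
  show _ * _ = _ * _
  -- The relation `h2` and its adjoint `h4` put the same rank-one term on opposite sides of the
  -- identity; the coefficients agree because `⟨h, k⟩` is real.
  rw [add_mul, mul_add, mul_add, h1, h2, ← h3, add_mul, mul_add, mul_add, h4]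
  abel

/-! ### The von Neumann algebra and its separating vacuum -/

theorem semicircular_mem_wignerAlgebra {h : OneParticle} (hh : ∀ᵐ x ∂halfLine, (h x).im = 0) :
    semicircular h ∈ wignerAlgebra :=
  Set.subset_centralizer_centralizer ⟨h, hh, rfl⟩

/-- The Wigner algebra, as a subalgebra. -/
def wignerSubalgebra : Subalgebra ℂ (Fock →L[ℂ] Fock) :=
  Subalgebra.centralizer ℂ (Set.centralizer
    {X | ∃ h : OneParticle, (∀ᵐ t ∂halfLine, (h t).im = 0) ∧ X = semicircular h})

theorem isClosed_wignerAlgebra : IsClosed wignerAlgebra :=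
  Set.isClosed_centralizer _

theorem rectangle_integral_mem (A : Rectangle n) : A.integral ∈ wignerAlgebra := by
  induction n with
  | zero =>
    have : A.integral = 1 := by simp [Rectangle.integral]
    rw [this]
    exact wignerSubalgebra.one_mem
  | succ n ih =>
    rw [A.integral_succ]
    exact wignerSubalgebra.mul_mem (ih A.init)
      (semicircular_mem_wignerAlgebra (intervalKernel_real _ _))

theorem simple_integral_mem (φ : Simple n) : φ.integral ∈ wignerAlgebra :=
  wignerSubalgebra.sum_mem fun A _ => wignerSubalgebra.smul_mem (rectangle_integral_mem A) _

/-- `integralL` is continuous into the operator norm, so `integralL n f` is a norm limit of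
integrals of simple functions, and a bicommutant is norm closed. -/
theorem integralL_mem (f : Kernel n) : integralL n f ∈ wignerAlgebra := by
  obtain ⟨φ, hφ⟩ := exists_simple_tendsto f
  refine isClosed_wignerAlgebra.mem_of_tendsto (((integralL n).continuous.tendsto f).comp hφ)
    (Eventually.of_forall fun k => ?_)
  rw [Function.comp_apply, integralL_simple]
  exact simple_integral_mem _

/-- Supplies elements of the commutant that send the vacuum to the reversed indicators of
rectangles, a total set in Fock space. -/
theorem flip_conj_rectangle_integral_mem (A : Rectangle n) :
    flip * A.integral * flip ∈ Set.centralizer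
      {X | ∃ h : OneParticle, (∀ᵐ t ∂halfLine, (h t).im = 0) ∧ X = semicircular h} := by
  induction n with
  | zero =>
    have : flip * A.integral * flip = 1 := by simp [Rectangle.integral, flip_mul_flip]
    rw [this]
    exact Set.one_mem_centralizer
  | succ n ih =>
    rw [A.integral_succ]
    have : flip * (A.init.integral * semicircular
        (intervalKernel (A.lower (Fin.last n)) (A.upper (Fin.last n)))) * flip =
        (flip * A.init.integral * flip) * (flip * semicircular
        (intervalKernel (A.lower (Fin.last n)) (A.upper (Fin.last n))) * flip) := by
      simp only [mul_assoc]
      rw [← mul_assoc flip flip, flip_mul_flip, one_mul]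
    rw [this]
    refine Set.mul_mem_centralizer (ih A.init) ?_
    rintro _ ⟨h, hh, rfl⟩
    exact commute_semicircular_flip hh (intervalKernel_real _ _)

/-- The vacuum is a separating vector of the Wigner algebra. -/
theorem eq_zero_of_vacuum_eq_zero {X : Fock →L[ℂ] Fock} (hX : X ∈ wignerAlgebra)
    (h0 : X vacuum = 0) : X = 0 := by
  -- `X` commutes with `flip * A.integral * flip`, so it kills the image of the vacuum under that
  -- operator, which is the reversal of the indicator of `A`.
  have key : X * flip = 0 := by
    refine fock_ext fun n A => ?_
    have h1 := hX _ (flip_conj_rectangle_integral_mem A)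
    have h2 := congrArg (fun T : Fock →L[ℂ] Fock => T vacuum) h1
    simp only [mul_apply_eq_comp, flip_vacuum, h0, map_zero] at h2
    rw [← integralL_rectangle, integralL_vacuum] at h2
    rw [mul_apply_eq_comp, ← h2]
    rfl
  calc X = X * flip * flip := by rw [mul_assoc, flip_mul_flip, mul_one]
    _ = 0 := by rw [key, zero_mul]

theorem eq_of_vacuum_eq {X Y : Fock →L[ℂ] Fock} (hX : X ∈ wignerAlgebra) (hY : Y ∈ wignerAlgebra)
    (h : X vacuum = Y vacuum) : X = Y :=
  sub_eq_zero.1 (eq_zero_of_vacuum_eq_zero (wignerSubalgebra.sub_mem hX hY) (by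
    rw [sub_apply, h, sub_self]))

/-! ### Characterisation of the integral and the product formula -/

theorem norm2_eq (X : Fock →L[ℂ] Fock) : norm2 X = ‖X vacuum‖ := by
  rw [norm2, vacuumState, mul_apply_eq_comp, ContinuousLinearMap.star_eq_adjoint,
    ContinuousLinearMap.adjoint_inner_right, inner_self_eq_norm_sq_to_K]
  norm_cast
  exact Real.sqrt_sq (norm_nonneg _)

/-- By `norm2_eq` the limit condition says that the vectors `(φ k).integral Ω` converge to `X Ω`.
They also converge to `integralL n f Ω`, and the vacuum separates elements of the algebra. -/
theorem isWignerIntegral_iff (f : Kernel n) (X : Fock →L[ℂ] Fock) :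
    IsWignerIntegral n f X ↔ X = integralL n f := by
  constructor
  · rintro ⟨hX, φ, hφ, hlim⟩
    refine eq_of_vacuum_eq hX (integralL_mem f) ?_
    have h1 : Tendsto (fun k => integralL n (φ k).kernel vacuum) atTop
        (𝓝 (integralL n f vacuum)) :=
      (((ContinuousLinearMap.apply ℂ Fock vacuum).continuous.comp
        (integralL n).continuous).tendsto f).comp hφ
    refine tendsto_nhds_unique (tendsto_iff_norm_sub_tendsto_zero.2 ?_) h1
    refine hlim.congr fun k => ?_
    rw [norm2_eq, sub_apply, integralL_simple]
  · rintro rfl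
    obtain ⟨φ, hφ⟩ := exists_simple_tendsto f
    refine ⟨integralL_mem f, φ, hφ, ?_⟩
    have h1 : Tendsto (fun k => integralL n (φ k).kernel vacuum) atTop
        (𝓝 (integralL n f vacuum)) :=
      (((ContinuousLinearMap.apply ℂ Fock vacuum).continuous.comp
        (integralL n).continuous).tendsto f).comp hφ
    refine (tendsto_iff_norm_sub_tendsto_zero.1 h1).congr fun k => ?_
    rw [norm2_eq, sub_apply, integralL_simple]

theorem existsUnique_isWignerIntegral (f : Kernel n) :
    ∃! X : Fock →L[ℂ] Fock, IsWignerIntegral n f X :=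
  ⟨integralL n f, (isWignerIntegral_iff f _).2 rfl, fun X hX => (isWignerIntegral_iff f X).1 hX⟩

theorem wignerIntegral_eq (f : Kernel n) : wignerIntegral n f = integralL n f :=
  (isWignerIntegral_iff f _).1 (Classical.epsilon_spec (existsUnique_isWignerIntegral f).exists)

theorem fits_of_fin (p : Fin (min n m + 1)) : Fits n m p (n + m - 2 * p) :=
  ⟨by omega, by omega, by omega⟩

/-- The product formula for multiple Wigner integrals. -/
theorem integralL_mul_integralL (f : Kernel n) (g : Kernel m) :
    integralL n f * integralL m g = ∑ p : Fin (min n m + 1),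
      integralL (n + m - 2 * p) (contr (fits_of_fin p) f g) := by
  -- Both sides lie in the algebra, so it suffices to compare them on the vacuum: the left side
  -- gives `integralL n f` applied to the vector `g`, which is the sum of the contractions.
  refine eq_of_vacuum_eq (wignerSubalgebra.mul_mem (integralL_mem f) (integralL_mem g))
    (wignerSubalgebra.sum_mem fun p _ => integralL_mem _) ?_
  rw [mul_apply_eq_comp, integralL_vacuum, integralL_apply, sum_apply, sum_apply,
    ← Finset.sum_subset (Finset.range_mono (by omega : min n m + 1 ≤ n + 1)), Finset.sum_range]
  · refine Finset.sum_congr rfl fun p _ => ?_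
    rw [integralL_vacuum, contractWith_single (fits_of_fin p)]
  · intro p _ hp
    rw [Finset.mem_range] at hp
    exact contractWith_single_of_not_le (by omega) _ _

end Wigner

end

theorem mainTheorem2 (n m : ℕ) (f : Wigner.Kernel n) (g : Wigner.Kernel m) :
    (∀ (k : ℕ) (h : Wigner.Kernel k), ∃! X : Wigner.Fock →L[ℂ] Wigner.Fock,
      Wigner.IsWignerIntegral k h X) ∧
    Wigner.wignerIntegral n f * Wigner.wignerIntegral m g =
      ∑ p : Fin (min n m + 1),
        Wigner.wignerIntegral (n + m - 2 * p)
          (Wigner.contraction p (by omega) (by omega) f g) := by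
  refine ⟨fun _ h => Wigner.existsUnique_isWignerIntegral h, ?_⟩
  simp only [Wigner.wignerIntegral_eq]
  -- For `c = n + m - 2 * p`, `contr` unfolds to `contraction`.
  exact Wigner.integralL_mul_integralL f g
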